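/- Let $0<\alpha<1/2$. Let $Z=(Z_n)_{n\ge 0}=((X_n,Y_n))_{n\ge 0}$ be the Markov chain on $\mathbb{Z}_+^2$ started at $Z_0=(1,1)$ with the following transition probabilities. If $xy\neq 0$, then from $(x,y)$ the chain jumps to each of the four nearest neighbours $(x\pm1,y)$, $(x,y\pm1)$ with probability $\frac14$. For every $i>0$, $$p((i,0),(i,1))=p((0,i),(1,i))=\frac{1}{2i^{\alpha}},\qquad p((i,0),(i+1,0))=p((0,i),(0,i+1))=1-\frac{1}{2i^{\alpha}},$$ and from $(0,0)$ the chain jumps to $(1,0)$ or $(0,1)$ with probability $\frac12$ each. For $z=(x,y)$ write $\overline{z}=\max(x,y)$. Put $\rho_0=0$ and, for $i\ge 1$, $$\eta_i=\inf\{k>\rho_{i-1}: X_kY_k=0\},\qquad \rho_i=\inf\{k>\eta_i: X_kY_k\neq 0\}.$$ Then, for every $j\ge 1$, the times $\eta_j$ and $\rho_j$ are almost surely finite and $\overline{Z}_{\rho_j}-\overline{Z}_{\eta_j}$ is square-integrable, and $$\lim_{i\to+\infty} i^{-(2\alpha+2)/(1-\alpha)}\,\mathbb{E}\left(\left(\sum_{j=1}^{i}\Big(\big(\overline{Z}_{\rho_j}-\overline{Z}_{\eta_j}\big)-\mathbb{E}\big(\overline{Z}_{\rho_j}-\overline{Z}_{\eta_j}\big)\Big)\right)^2\right)=0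 .$$ -/

import Mathlib

open MeasureTheory Filter Topology

noncomputable section

namespace AxisWalk

/-- Transition probabilities of the axis-driven walk on the quadrant `ℕ × ℕ`: simple random walk
off the axes; at distance `i > 0` from the origin on an axis, step into the open quadrant with
probability `1 / (2 i ^ α)` and outwards along the axis with the remaining probability; from the
origin, step to `(1, 0)` or `(0, 1)` with probability `1 / 2` each. -/
def transition (α : ℝ) : ℕ × ℕ → ℕ × ℕ → ℝ
  | (0, 0), w => if w = (1, 0) ∨ w = (0, 1) then 1 / 2 else 0
  | (i + 1, 0), w =>
      if w = (i + 1, 1) then 1 / (2 * ((i + 1 : ℕ) : ℝ) ^ α)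
      else if w = (i + 2, 0) then 1 - 1 / (2 * ((i + 1 : ℕ) : ℝ) ^ α)
      else 0
  | (0, i + 1), w =>
      if w = (1, i + 1) then 1 / (2 * ((i + 1 : ℕ) : ℝ) ^ α)
      else if w = (0, i + 2) then 1 - 1 / (2 * ((i + 1 : ℕ) : ℝ) ^ α)
      else 0
  | (x + 1, y + 1), w =>
      if w = (x + 2, y + 1) ∨ w = (x, y + 1) ∨ w = (x + 1, y + 2) ∨ w = (x + 1, y) then 1 / 4
      else 0

/-- Under `μ`, the process `Z` is the Markov chain with the transition probabilities above
and started at `z₀`, expressed through its finite-dimensional distributions. -/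
structure IsAxisDrivenWalk {Ω : Type*} [MeasurableSpace Ω] (α : ℝ) (z₀ : ℕ × ℕ)
    (μ : Measure Ω) (Z : ℕ → Ω → ℕ × ℕ) : Prop where
  measurable : ∀ n, Measurable (Z n)
  law : ∀ (n : ℕ) (z : ℕ → ℕ × ℕ),
    μ.real {ω | ∀ k ≤ n, Z k ω = z k} =
      if z 0 = z₀ then ∏ k ∈ Finset.range n, transition α (z k) (z (k + 1)) else 0

/-- The dominant coordinate of a point. -/
def dom (z : ℕ × ℕ) : ℕ := max z.1 z.2

/-- The first time strictly after `m` at which the path `s` is in `A` (`⊤` if there is none). -/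
def nextVisit (s : ℕ → ℕ × ℕ) (A : Set (ℕ × ℕ)) (m : ℕ∞) : ℕ∞ :=
  ⨅ (k : ℕ) (_ : m < (k : ℕ∞) ∧ s k ∈ A), (k : ℕ∞)

/-- The union of the two axes. -/
def axes : Set (ℕ × ℕ) := {z | z.1 * z.2 = 0}

/-- The times `ρ i`: `ρ 0 = 0`, and `ρ (i + 1)` is the first time off the axes after `η (i + 1)`,
where `η (i + 1)` is the first time on the axes after `ρ i`. -/
def rho (s : ℕ → ℕ × ℕ) : ℕ → ℕ∞
  | 0 => 0
  | i + 1 => nextVisit s axesᶜ (nextVisit s axes (rho s i))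

/-- The times `η i` for `i ≥ 1` (the value at `0` is a convention and is never used). -/
def eta (s : ℕ → ℕ × ℕ) : ℕ → ℕ∞
  | 0 => 0
  | i + 1 => nextVisit s axes (rho s i)

theorem rho_succ (s : ℕ → ℕ × ℕ) (i : ℕ) :
    rho s (i + 1) = nextVisit s axesᶜ (eta s (i + 1)) := rfl

/-- Increment of the dominant coordinate along an axis during the `j`-th visit to the axes, as a
function of the path. (If one of the two times is infinite, the value has no meaning.) -/
def axisIncrement (s : ℕ → ℕ × ℕ) (j : ℕ) : ℝ :=
  (dom (s (rho s j).toNat) : ℝ) - (dom (s (eta s j).toNat) : ℝ)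

end AxisWalk

end

/-! No decorrelation between visits is needed. By Cauchy–Schwarz the second moment of the centred
sum is at most `i` times the sum of the second moments of the increments. If the `j`-th of these is
O(j^q) with q = 2α/(1-α), the total is O(i^(2+q)), and 2+q = 2/(1-α) falls short of the normalising
exponent (2α+2)/(1-α) by exactly q > 0.

An increment is at most the time spent on the axis, because the dominant coordinate moves by at most
one per step. At distance x the exit probability is of order x^(-α), so for entry at x this time has
first and second moments O(1+x^α) and O(1+x^(2α)); `exists_axisTime_bounds` gives explicit
supersolutions. The coordinate sum is harmonic off the axes, so its mean does not increase from ρ_j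
to η_{j+1}; on an axis it grows by the time spent there. By concavity the means satisfy m_{j+1} ≤
m_j + C(1+m_j^α), whence m_j = O(j^(1/(1-α))) (`exists_stoppedMean_rho_le`). Since 2α < 1, concavity
also bounds the mean of x^(2α) by O(j^q) (`exists_lintegral_sq_axisIncrement_le`).

All these means come from one optional stopping inequality, `dynkin`. It also gives finiteness: of ρ
through the time moments, of η through a bounded strictly superharmonic function of one coordinate.
-/

open scoped ENNReal

namespace AxisWalk

/-! ### Markov property from the finite-dimensional distributions. -/

/-- The set `S` of paths is determined by the path up to time `n`. -/
def DeterminedBy (n : ℕ) (S : Set (ℕ → ℕ × ℕ)) : Prop :=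
  ∀ s s' : ℕ → ℕ × ℕ, (∀ k ≤ n, s k = s' k) → s ∈ S → s' ∈ S

/-- Extension of a finite path by the origin. -/
def extendPath {n : ℕ} (v : Fin (n + 1) → ℕ × ℕ) (k : ℕ) : ℕ × ℕ :=
  if h : k < n + 1 then v ⟨k, h⟩ else (0, 0)

/-- Mean of `f` after one step of the walk from `z`. -/
noncomputable def stepMean (α : ℝ) (f : ℕ × ℕ → ℝ≥0∞) (z : ℕ × ℕ) : ℝ≥0∞ :=
  ∑' w, ENNReal.ofReal (transition α z w) * f w

lemma DeterminedBy.inter {n : ℕ} {S T : Set (ℕ → ℕ × ℕ)} (hS : DeterminedBy n S)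
    (hT : DeterminedBy n T) : DeterminedBy n (S ∩ T) :=
  fun s s' h hs => ⟨hS s s' h hs.1, hT s s' h hs.2⟩

lemma DeterminedBy.mono {m n : ℕ} {S : Set (ℕ → ℕ × ℕ)} (hS : DeterminedBy m S) (h : m ≤ n) :
    DeterminedBy n S :=
  fun s s' hs => hS s s' fun k hk => hs k (hk.trans h)

lemma determinedBy_eval {n : ℕ} {k : ℕ} (hk : k ≤ n) (A : Set (ℕ × ℕ)) :
    DeterminedBy n {s | s k ∈ A} := by
  intro s s' h hs
  simpa [← h k hk] using hs

lemma DeterminedBy.mem_iff_extendPath {n : ℕ} {S : Set (ℕ → ℕ × ℕ)} (hS : DeterminedBy n S)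
    (s : ℕ → ℕ × ℕ) : s ∈ S ↔ extendPath (fun k : Fin (n + 1) => s k) ∈ S := by
  have h : ∀ k ≤ n, s k = extendPath (fun k : Fin (n + 1) => s k) k := by
    intro k hk
    simp [extendPath, Nat.lt_succ_of_le hk]
  exact ⟨hS _ _ h, hS _ _ fun k hk => (h k hk).symm⟩

section

variable {Ω : Type*} [MeasurableSpace Ω] {μ : Measure Ω} {α : ℝ} {z₀ : ℕ × ℕ}
  {Z : ℕ → Ω → ℕ × ℕ}

lemma IsAxisDrivenWalk.measurable_prefix (hZ : IsAxisDrivenWalk α z₀ μ Z) (n : ℕ) :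
    Measurable fun ω => (fun k : Fin (n + 1) => Z k ω) :=
  measurable_pi_lambda _ fun k => hZ.measurable k

/-- The event is the preimage of a set of finite prefixes, and these form a countable type in which
every set is measurable. -/
lemma IsAxisDrivenWalk.measurableSet (hZ : IsAxisDrivenWalk α z₀ μ Z) {n : ℕ}
    {S : Set (ℕ → ℕ × ℕ)} (hS : DeterminedBy n S) :
    MeasurableSet {ω | (fun k => Z k ω) ∈ S} := by
  have : {ω | (fun k => Z k ω) ∈ S} =
      (fun ω => (fun k : Fin (n + 1) => Z k ω)) ⁻¹' {v | extendPath v ∈ S} := by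
    ext ω
    exact hS.mem_iff_extendPath _
  rw [this]
  exact hZ.measurable_prefix n (Set.to_countable _).measurableSet

lemma lintegral_comp_countable {β : Type*} [MeasurableSpace β] [Countable β]
    [MeasurableSingletonClass β] {X : Ω → β} (hX : Measurable X) (g : β → ℝ≥0∞) :
    ∫⁻ ω, g (X ω) ∂μ = ∑' x, g x * μ (X ⁻¹' {x}) := by
  rw [← lintegral_map (measurable_of_countable g) hX, lintegral_countable']
  refine tsum_congr fun x => ?_
  rw [Measure.map_apply hX (measurableSet_singleton x)]

lemma IsAxisDrivenWalk.measure_prefix_succ [IsProbabilityMeasure μ]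
    (hZ : IsAxisDrivenWalk α z₀ μ Z) (n : ℕ) (v : Fin (n + 1) → ℕ × ℕ) (w : ℕ × ℕ) :
    μ ((fun ω => ((fun k : Fin (n + 1) => Z k ω), Z (n + 1) ω)) ⁻¹' {(v, w)}) =
      μ ((fun ω => (fun k : Fin (n + 1) => Z k ω)) ⁻¹' {v}) *
        ENNReal.ofReal (transition α (v (Fin.last n)) w) := by
  let z : ℕ → ℕ × ℕ := fun k => if h : k < n + 1 then v ⟨k, h⟩ else w
  have hz : ∀ k : Fin (n + 1), z k = v k := fun k => dif_pos k.2
  have hzn : z n = v (Fin.last n) := hz (Fin.last n)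
  have hzw : z (n + 1) = w := by simp [z]
  have h1 : (fun ω => (fun k : Fin (n + 1) => Z k ω)) ⁻¹' {v} = {ω | ∀ k ≤ n, Z k ω = z k} := by
    ext ω
    simp only [Set.mem_preimage, Set.mem_singleton_iff, Set.mem_ofPred_eq, funext_iff]
    constructor
    · intro h k hk
      rw [show k = ((⟨k, Nat.lt_succ_of_le hk⟩ : Fin (n + 1)) : ℕ) from rfl, hz]
      exact h _
    · intro h k
      rw [h k (Nat.le_of_lt_succ k.2), hz]
  have h2 : (fun ω => ((fun k : Fin (n + 1) => Z k ω), Z (n + 1) ω)) ⁻¹' {(v, w)} =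
      {ω | ∀ k ≤ n + 1, Z k ω = z k} := by
    have : (fun ω => ((fun k : Fin (n + 1) => Z k ω), Z (n + 1) ω)) ⁻¹' {(v, w)} =
        (fun ω => (fun k : Fin (n + 1) => Z k ω)) ⁻¹' {v} ∩ {ω | Z (n + 1) ω = w} := by
      ext ω
      simp [Prod.ext_iff]
    rw [this, h1]
    ext ω
    simp only [Set.mem_inter_iff, Set.mem_ofPred_eq]
    constructor
    · rintro ⟨h, h'⟩ k hk
      rcases Nat.le_succ_iff.1 hk with hk | rfl
      · exact h k hk
      · rw [h', hzw]
    · intro h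
      exact ⟨fun k hk => h k (by omega), by rw [h _ le_rfl, hzw]⟩
  rw [h1, h2, ← ofReal_measureReal, ← ofReal_measureReal, ← ENNReal.ofReal_mul measureReal_nonneg,
    hZ.law, hZ.law, Finset.prod_range_succ, hzn, hzw]
  split_ifs <;> simp

/-- The Markov property, integrated over an event determined by the past. -/
lemma IsAxisDrivenWalk.setLIntegral_succ [IsProbabilityMeasure μ]
    (hZ : IsAxisDrivenWalk α z₀ μ Z) {n : ℕ} {S : Set (ℕ → ℕ × ℕ)} (hS : DeterminedBy n S)
    (f : ℕ × ℕ → ℝ≥0∞) :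
    ∫⁻ ω in {ω | (fun k => Z k ω) ∈ S}, f (Z (n + 1) ω) ∂μ =
      ∫⁻ ω in {ω | (fun k => Z k ω) ∈ S}, stepMean α f (Z n ω) ∂μ := by
  classical
  -- Both sides become sums over finite prefixes, where the law is the prefix mass times one
  -- transition.
  let F : (Fin (n + 1) → ℕ × ℕ) × (ℕ × ℕ) → ℝ≥0∞ := fun p =>
    if extendPath p.1 ∈ S then f p.2 else 0
  let G : (Fin (n + 1) → ℕ × ℕ) → ℝ≥0∞ := fun v =>
    if extendPath v ∈ S then stepMean α f (v (Fin.last n)) else 0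
  have hF : ∫⁻ ω in {ω | (fun k => Z k ω) ∈ S}, f (Z (n + 1) ω) ∂μ =
      ∫⁻ ω, F ((fun k : Fin (n + 1) => Z k ω), Z (n + 1) ω) ∂μ := by
    rw [← lintegral_indicator (hZ.measurableSet hS)]
    refine lintegral_congr fun ω => ?_
    simp only [Set.indicator_apply, Set.mem_ofPred_eq, F, hS.mem_iff_extendPath fun k => Z k ω]
  have hG : ∫⁻ ω in {ω | (fun k => Z k ω) ∈ S}, stepMean α f (Z n ω) ∂μ =
      ∫⁻ ω, G (fun k : Fin (n + 1) => Z k ω) ∂μ := by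
    rw [← lintegral_indicator (hZ.measurableSet hS)]
    refine lintegral_congr fun ω => ?_
    simp only [Set.indicator_apply, Set.mem_ofPred_eq, G, hS.mem_iff_extendPath fun k => Z k ω,
      Fin.val_last]
  rw [hF, hG, lintegral_comp_countable ((hZ.measurable_prefix n).prodMk (hZ.measurable (n + 1))) F,
    lintegral_comp_countable (hZ.measurable_prefix n) G, ENNReal.tsum_prod']
  refine tsum_congr fun v => ?_
  simp only [hZ.measure_prefix_succ, F, G]
  split_ifs
  · rw [stepMean, ← ENNReal.tsum_mul_right]
    exact tsum_congr fun w => by ring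
  · simp

/-- The walk almost surely starts at `z₀`. -/
lemma IsAxisDrivenWalk.ae_zero [IsProbabilityMeasure μ] (hZ : IsAxisDrivenWalk α z₀ μ Z) :
    ∀ᵐ ω ∂μ, Z 0 ω = z₀ := by
  have h := hZ.law 0 fun _ => z₀
  have h2 : μ {ω | Z 0 ω = z₀} = 1 := by
    have h3 : μ.real {ω | Z 0 ω = z₀} = 1 := by simpa using h
    rw [← ofReal_measureReal, h3, ENNReal.ofReal_one]
  exact (prob_compl_eq_zero_iff (hZ.measurable 0 (measurableSet_singleton z₀))).2 h2

/-- Testing the Markov property against the indicator of one target excludes each forbidden pair,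
and there are countably many pairs. -/
lemma IsAxisDrivenWalk.ae_transition_ne_zero [IsProbabilityMeasure μ]
    (hZ : IsAxisDrivenWalk α z₀ μ Z) (n : ℕ) :
    ∀ᵐ ω ∂μ, transition α (Z n ω) (Z (n + 1) ω) ≠ 0 := by
  have key : ∀ z w : ℕ × ℕ, transition α z w = 0 → ∀ᵐ ω ∂μ, ¬ (Z n ω = z ∧ Z (n + 1) ω = w) := by
    intro z w h
    have h1 := hZ.setLIntegral_succ (determinedBy_eval (le_refl n) {z})
      (Set.indicator {w} fun _ => 1)
    have hms : MeasurableSet {ω | Z n ω ∈ ({z} : Set (ℕ × ℕ))} :=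
      hZ.measurable n (measurableSet_singleton z)
    have h2 : ∫⁻ ω in {ω | Z n ω ∈ ({z} : Set (ℕ × ℕ))},
        stepMean α (Set.indicator {w} fun _ => 1) (Z n ω) ∂μ = 0 := by
      rw [setLIntegral_congr_fun (g := fun _ => 0) hms, lintegral_zero]
      intro ω hω
      have hω' : Z n ω = z := hω
      simp only [stepMean, hω', ENNReal.tsum_eq_zero]
      intro w'
      by_cases hw : w' = w
      · simp [hw, h]
      · simp [hw]
    have h3 : (∫⁻ ω in {ω | Z n ω ∈ ({z} : Set (ℕ × ℕ))},
        (Set.indicator {w} (fun _ => 1) (Z (n + 1) ω) : ℝ≥0∞) ∂μ) = 0 := h1.trans h2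
    have h4 := (lintegral_eq_zero_iff ((measurable_of_countable
      (Set.indicator {w} fun _ => (1 : ℝ≥0∞))).comp (hZ.measurable (n + 1)))).1 h3
    rw [Filter.EventuallyEq, ae_restrict_iff' hms] at h4
    filter_upwards [h4] with ω hω hzw
    have := hω hzw.1
    simp [hzw.2] at this
  have h' : ∀ᵐ ω ∂μ, ∀ z w : ℕ × ℕ, transition α z w = 0 → ¬ (Z n ω = z ∧ Z (n + 1) ω = w) := by
    rw [ae_all_iff]; intro z
    rw [ae_all_iff]; intro w
    by_cases h : transition α z w = 0
    · filter_upwards [key z w h] with ω hω _ using hω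
    · exact Eventually.of_forall fun ω h' => absurd h' h
  filter_upwards [h'] with ω hω h0
  exact hω _ _ h0 ⟨rfl, rfl⟩

end

/-! ### Visit times as stopping times. -/

lemma nextVisit_eq_coe_iff (s : ℕ → ℕ × ℕ) (A : Set (ℕ × ℕ)) (m : ℕ∞) (n : ℕ) :
    nextVisit s A m = n ↔ m < n ∧ s n ∈ A ∧ ∀ l : ℕ, m < l → l < n → s l ∉ A := by
  have hle : ∀ l : ℕ, m < l → s l ∈ A → nextVisit s A m ≤ l := fun l h1 h2 =>
    iInf₂_le (f := fun (k : ℕ) (_ : m < (k : ℕ∞) ∧ s k ∈ A) => (k : ℕ∞)) l ⟨h1, h2⟩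
  constructor
  · intro h
    -- An infimum equal to `n` lies below `n + 1`, which yields an actual index realising it.
    have h1 : nextVisit s A m < ((n + 1 : ℕ) : ℕ∞) := by
      rw [h]; exact_mod_cast Nat.lt_succ_self n
    rw [nextVisit] at h1
    simp only [iInf_lt_iff] at h1
    obtain ⟨k, hk, hkn⟩ := h1
    have h2 := hle k hk.1 hk.2
    rw [h] at h2
    have h3 : n ≤ k := by exact_mod_cast h2
    have h4 : k < n + 1 := by exact_mod_cast hkn
    obtain rfl : k = n := by omega
    refine ⟨hk.1, hk.2, fun l hl hlk hA => ?_⟩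
    have h5 := hle l hl hA
    rw [h] at h5
    have h6 : k ≤ l := by exact_mod_cast h5
    omega
  · rintro ⟨h1, h2, h3⟩
    refine le_antisymm (hle n h1 h2) (le_iInf₂ fun k hk => ?_)
    by_contra h
    exact h3 k hk.1 (by exact_mod_cast not_le.1 h) hk.2

/-- The random time `τ` is a stopping time: `τ = n` is decided by the path up to time `n`. -/
def Causal (τ : (ℕ → ℕ × ℕ) → ℕ∞) : Prop := ∀ n : ℕ, DeterminedBy n {s | τ s = n}

/-- The inequality in `nextVisit` is strict, so a visit at time `n` forces `τ` to be below `n`,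
where the path up to `n` decides its value. -/
lemma Causal.nextVisit {τ : (ℕ → ℕ × ℕ) → ℕ∞} (hτ : Causal τ) (A : Set (ℕ × ℕ)) :
    Causal fun s => nextVisit s A (τ s) := by
  intro n s s' h hs
  simp only [Set.mem_ofPred_eq, nextVisit_eq_coe_iff] at hs ⊢
  obtain ⟨h1, h2, h3⟩ := hs
  obtain ⟨m, hm⟩ := ENat.ne_top_iff_exists.1 (ne_top_of_lt h1)
  have hmn : m < n := by rw [← hm] at h1; exact_mod_cast h1
  have hm' : τ s' = m := hτ m s s' (fun k hk => h k (by omega)) hm.symm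
  rw [hm', hm]
  refine ⟨h1, h n le_rfl ▸ h2, fun l hl hln => ?_⟩
  rw [← h l hln.le]
  exact h3 l hl hln

lemma causal_rho (j : ℕ) : Causal fun s => rho s j := by
  induction j with
  | zero =>
    intro n s s' _ hs
    exact hs
  | succ j ih => exact (ih.nextVisit axes).nextVisit axesᶜ

lemma causal_eta (j : ℕ) : Causal fun s => eta s (j + 1) := (causal_rho j).nextVisit axes

/-! ### Dynkin's inequality up to the first visit to a set. -/

section

variable {Ω : Type*} [MeasurableSpace Ω] {μ : Measure Ω} {α : ℝ} {z₀ : ℕ × ℕ}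
  {Z : ℕ → Ω → ℕ × ℕ}

/-- Paths in `S` which avoid `B` from time `k` to time `k + t`. -/
def avoiding (S : Set (ℕ → ℕ × ℕ)) (B : Set (ℕ × ℕ)) (k t : ℕ) : Set (ℕ → ℕ × ℕ) :=
  {s | s ∈ S ∧ ∀ l, k ≤ l → l ≤ k + t → s l ∉ B}

lemma DeterminedBy.avoiding {S : Set (ℕ → ℕ × ℕ)} {k : ℕ} (hS : DeterminedBy k S)
    (B : Set (ℕ × ℕ)) (t : ℕ) : DeterminedBy (k + t) (avoiding S B k t) := by
  intro s s' h hs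
  refine ⟨hS s s' (fun l hl => h l (by omega)) hs.1, fun l h1 h2 => ?_⟩
  rw [← h l h2]
  exact hs.2 l h1 h2

lemma determinedBy_nextVisit (B : Set (ℕ × ℕ)) (k n : ℕ) :
    DeterminedBy n {s | AxisWalk.nextVisit s B k = n} := by
  intro s s' h hs
  simp only [Set.mem_ofPred_eq, nextVisit_eq_coe_iff] at hs ⊢
  refine ⟨hs.1, h n le_rfl ▸ hs.2.1, fun l h1 h2 => ?_⟩
  rw [← h l h2.le]
  exact hs.2.2 l h1 h2

/-- Paths in `S` whose first visit to `B` after time `k` happens at time `n`. -/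
def hitting (S : Set (ℕ → ℕ × ℕ)) (B : Set (ℕ × ℕ)) (k n : ℕ) : Set (ℕ → ℕ × ℕ) :=
  {s | s ∈ S ∧ AxisWalk.nextVisit s B k = n}

lemma DeterminedBy.hitting {S : Set (ℕ → ℕ × ℕ)} {k : ℕ} (hS : DeterminedBy k S)
    (B : Set (ℕ × ℕ)) {n : ℕ} (hn : k ≤ n) : DeterminedBy n (hitting S B k n) :=
  (hS.mono hn).inter (determinedBy_nextVisit B k n)

/-- Dynkin's inequality for a function which is superharmonic in space-time off `B`. -/
lemma IsAxisDrivenWalk.dynkin [IsProbabilityMeasure μ] (hZ : IsAxisDrivenWalk α z₀ μ Z)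
    {k : ℕ} {S : Set (ℕ → ℕ × ℕ)} (hS : DeterminedBy k S) {B : Set (ℕ × ℕ)}
    (hSB : ∀ s ∈ S, s k ∉ B) (f : ℕ → ℕ × ℕ → ℝ≥0∞) (r : ℕ × ℕ → ℝ≥0∞)
    (hf : ∀ n, k ≤ n → ∀ z ∉ B, stepMean α (f (n + 1)) z + r z ≤ f n z) (T : ℕ) :
    ∑ n ∈ Finset.range (k + T + 1), ∫⁻ ω in {ω | (fun i => Z i ω) ∈ hitting S B k n},
        f n (Z n ω) ∂μ +
      ∑ t ∈ Finset.range T, ∫⁻ ω in {ω | (fun i => Z i ω) ∈ avoiding S B k t},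
        r (Z (k + t) ω) ∂μ +
      ∫⁻ ω in {ω | (fun i => Z i ω) ∈ avoiding S B k T}, f (k + T) (Z (k + T) ω) ∂μ ≤
    ∫⁻ ω in {ω | (fun i => Z i ω) ∈ S}, f k (Z k ω) ∂μ := by
  induction T with
  | zero =>
    have h1 : ∀ n ∈ Finset.range (k + 0 + 1),
        ∫⁻ ω in {ω | (fun i => Z i ω) ∈ hitting S B k n}, f n (Z n ω) ∂μ = 0 := by
      intro n hn
      have : {ω | (fun i => Z i ω) ∈ hitting S B k n} = ∅ := by
        ext ω
        simp only [hitting, Set.mem_ofPred_eq, nextVisit_eq_coe_iff, Nat.cast_lt,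
          Set.mem_empty_iff_false, iff_false]
        have := Finset.mem_range.1 hn
        rintro ⟨_, h, _⟩
        omega
      rw [this]; simp
    rw [Finset.sum_eq_zero h1]
    simp only [Finset.range_zero, Finset.sum_empty, zero_add, add_zero]
    refine lintegral_mono_set fun ω hω => hω.1
  | succ T ih =>
    refine le_trans ?_ ih
    have hdis : Disjoint {ω | (fun i => Z i ω) ∈ hitting S B k (k + T + 1)}
        {ω | (fun i => Z i ω) ∈ avoiding S B k (T + 1)} := by
      rw [Set.disjoint_left]
      rintro ω ⟨_, h1⟩ ⟨_, h2⟩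
      rw [nextVisit_eq_coe_iff] at h1
      exact h2 (k + T + 1) (by omega) (by omega) h1.2.1
    have hun : {ω | (fun i => Z i ω) ∈ hitting S B k (k + T + 1)} ∪
        {ω | (fun i => Z i ω) ∈ avoiding S B k (T + 1)} ⊆
        {ω | (fun i => Z i ω) ∈ avoiding S B k T} := by
      rintro ω (⟨h0, h1⟩ | ⟨h0, h1⟩)
      · refine ⟨h0, fun l hl hl' => ?_⟩
        rw [nextVisit_eq_coe_iff] at h1
        rcases hl.eq_or_lt with rfl | hlt
        · exact hSB _ h0
        · exact h1.2.2 l (by exact_mod_cast hlt) (by omega)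
      · exact ⟨h0, fun l hl hl' => h1 l hl (by omega)⟩
    -- One Markov step on the paths still off `B`: they split into first visits at `k + T + 1` and
    -- continued avoidance.
    have hstep : ∫⁻ ω in {ω | (fun i => Z i ω) ∈ hitting S B k (k + T + 1)},
          f (k + T + 1) (Z (k + T + 1) ω) ∂μ +
        ∫⁻ ω in {ω | (fun i => Z i ω) ∈ avoiding S B k (T + 1)},
          f (k + T + 1) (Z (k + T + 1) ω) ∂μ +
        ∫⁻ ω in {ω | (fun i => Z i ω) ∈ avoiding S B k T}, r (Z (k + T) ω) ∂μ ≤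
        ∫⁻ ω in {ω | (fun i => Z i ω) ∈ avoiding S B k T}, f (k + T) (Z (k + T) ω) ∂μ := by
      rw [← lintegral_union (hZ.measurableSet (hS.avoiding B (T + 1))) hdis]
      refine (add_le_add_left (lintegral_mono_set hun) _).trans ?_
      rw [hZ.setLIntegral_succ (hS.avoiding B T),
        ← lintegral_add_left (show Measurable fun ω => stepMean α (f (k + T + 1)) (Z (k + T) ω) from
          (measurable_of_countable (stepMean α (f (k + T + 1)))).comp (hZ.measurable (k + T)))]
      refine setLIntegral_mono' (hZ.measurableSet (hS.avoiding B T)) fun ω hω => ?_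
      exact hf (k + T) (by omega) _ (hω.2 (k + T) (by omega) le_rfl)
    rw [show k + (T + 1) + 1 = (k + T + 1) + 1 by ring, Finset.sum_range_succ,
      Finset.sum_range_succ _ T, show k + (T + 1) = k + T + 1 by ring]
    rw [add_add_add_comm, add_assoc]
    gcongr
    rwa [add_right_comm]

lemma IsAxisDrivenWalk.tsum_hitting_le [IsProbabilityMeasure μ] (hZ : IsAxisDrivenWalk α z₀ μ Z)
    {k : ℕ} {S : Set (ℕ → ℕ × ℕ)} (hS : DeterminedBy k S) {B : Set (ℕ × ℕ)}
    (hSB : ∀ s ∈ S, s k ∉ B) (f : ℕ → ℕ × ℕ → ℝ≥0∞)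
    (hf : ∀ n, k ≤ n → ∀ z ∉ B, stepMean α (f (n + 1)) z ≤ f n z) :
    ∑' n, ∫⁻ ω in {ω | (fun i => Z i ω) ∈ hitting S B k n}, f n (Z n ω) ∂μ ≤
      ∫⁻ ω in {ω | (fun i => Z i ω) ∈ S}, f k (Z k ω) ∂μ := by
  refine ENNReal.tsum_le_of_sum_range_le fun T => ?_
  have h := hZ.dynkin hS hSB f (fun _ => 0) (by simpa using hf) T
  refine le_trans ?_ (le_trans (le_self_add.trans le_self_add) h)
  exact Finset.sum_le_sum_of_subset (Finset.range_mono (by omega))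

lemma IsAxisDrivenWalk.setLIntegral_avoiding_le [IsProbabilityMeasure μ]
    (hZ : IsAxisDrivenWalk α z₀ μ Z)
    {k : ℕ} {S : Set (ℕ → ℕ × ℕ)} (hS : DeterminedBy k S) {B : Set (ℕ × ℕ)}
    (hSB : ∀ s ∈ S, s k ∉ B) (f : ℕ → ℕ × ℕ → ℝ≥0∞)
    (hf : ∀ n, k ≤ n → ∀ z ∉ B, stepMean α (f (n + 1)) z ≤ f n z) (T : ℕ) :
    ∫⁻ ω in {ω | (fun i => Z i ω) ∈ avoiding S B k T}, f (k + T) (Z (k + T) ω) ∂μ ≤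
      ∫⁻ ω in {ω | (fun i => Z i ω) ∈ S}, f k (Z k ω) ∂μ :=
  le_trans le_add_self (hZ.dynkin hS hSB f (fun _ => 0) (by simpa using hf) T)

lemma IsAxisDrivenWalk.tsum_avoiding_le [IsProbabilityMeasure μ]
    (hZ : IsAxisDrivenWalk α z₀ μ Z)
    {k : ℕ} {S : Set (ℕ → ℕ × ℕ)} (hS : DeterminedBy k S) {B : Set (ℕ × ℕ)}
    (hSB : ∀ s ∈ S, s k ∉ B) (f r : ℕ × ℕ → ℝ≥0∞)
    (hf : ∀ z ∉ B, stepMean α f z + r z ≤ f z) :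
    ∑' t, ∫⁻ ω in {ω | (fun i => Z i ω) ∈ avoiding S B k t}, r (Z (k + t) ω) ∂μ ≤
      ∫⁻ ω in {ω | (fun i => Z i ω) ∈ S}, f (Z k ω) ∂μ := by
  refine ENNReal.tsum_le_of_sum_range_le fun T => ?_
  exact le_trans (le_add_self.trans le_self_add)
    (hZ.dynkin hS hSB (fun _ => f) r (fun _ _ => hf) T)

end

/-! ### One-step means. -/

/-- Probability to leave the axis at distance `i`. -/
noncomputable def exitProb (α : ℝ) (i : ℕ) : ℝ := 1 / (2 * (i : ℝ) ^ α)

lemma exitProb_nonneg (α : ℝ) (i : ℕ) : 0 ≤ exitProb α i := by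
  unfold exitProb; positivity

lemma exitProb_le_one {α : ℝ} (hα : 0 < α) {i : ℕ} (hi : 1 ≤ i) : exitProb α i ≤ 1 := by
  have h : (1 : ℝ) ≤ (i : ℝ) ^ α := Real.one_le_rpow (by exact_mod_cast hi) hα.le
  unfold exitProb
  rw [div_le_one (by positivity)]
  linarith

lemma stepMean_eq_pair {α : ℝ} {z u w : ℕ × ℕ} (huw : u ≠ w) {f : ℕ × ℕ → ℝ} (hf : ∀ z, 0 ≤ f z)
    (hu : 0 ≤ transition α z u) (hw : 0 ≤ transition α z w)
    (h : ∀ x, x ≠ u → x ≠ w → transition α z x = 0) :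
    stepMean α (fun z => ENNReal.ofReal (f z)) z =
      ENNReal.ofReal (transition α z u * f u + transition α z w * f w) := by
  rw [stepMean, tsum_eq_sum (s := {u, w}), Finset.sum_pair huw, ← ENNReal.ofReal_mul hu,
    ← ENNReal.ofReal_mul hw, ENNReal.ofReal_add (mul_nonneg hu (hf _)) (mul_nonneg hw (hf _))]
  intro x hx
  simp only [Finset.mem_insert, Finset.mem_singleton, not_or] at hx
  simp [h x hx.1 hx.2]

lemma stepMean_origin {α : ℝ} {f : ℕ × ℕ → ℝ} (hf : ∀ z, 0 ≤ f z) :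
    stepMean α (fun z => ENNReal.ofReal (f z)) (0, 0) =
      ENNReal.ofReal (1 / 2 * f (1, 0) + 1 / 2 * f (0, 1)) := by
  rw [stepMean_eq_pair (u := (1, 0)) (w := (0, 1)) (by simp) hf]
  · simp [transition]
  · simp [transition]
  · simp [transition]
  · intro x h1 h2
    simp [transition, h1, h2]

lemma stepMean_fst_axis {α : ℝ} (hα : 0 < α) {f : ℕ × ℕ → ℝ} (hf : ∀ z, 0 ≤ f z) (i : ℕ) :
    stepMean α (fun z => ENNReal.ofReal (f z)) (i + 1, 0) =
      ENNReal.ofReal (exitProb α (i + 1) * f (i + 1, 1) +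
        (1 - exitProb α (i + 1)) * f (i + 2, 0)) := by
  have h1 : transition α (i + 1, 0) (i + 1, 1) = exitProb α (i + 1) := by
    simp [transition, exitProb]
  have h2 : transition α (i + 1, 0) (i + 2, 0) = 1 - exitProb α (i + 1) := by
    simp [transition, exitProb]
  rw [stepMean_eq_pair (u := (i + 1, 1)) (w := (i + 2, 0)) (by simp) hf, h1, h2]
  · rw [h1]; exact exitProb_nonneg _ _
  · rw [h2]; exact sub_nonneg.2 (exitProb_le_one hα (by omega))
  · intro x h1 h2
    simp [transition, h1, h2]

lemma stepMean_snd_axis {α : ℝ} (hα : 0 < α) {f : ℕ × ℕ → ℝ} (hf : ∀ z, 0 ≤ f z) (i : ℕ) :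
    stepMean α (fun z => ENNReal.ofReal (f z)) (0, i + 1) =
      ENNReal.ofReal (exitProb α (i + 1) * f (1, i + 1) +
        (1 - exitProb α (i + 1)) * f (0, i + 2)) := by
  have h1 : transition α (0, i + 1) (1, i + 1) = exitProb α (i + 1) := by
    simp [transition, exitProb]
  have h2 : transition α (0, i + 1) (0, i + 2) = 1 - exitProb α (i + 1) := by
    simp [transition, exitProb]
  rw [stepMean_eq_pair (u := (1, i + 1)) (w := (0, i + 2)) (by simp) hf, h1, h2]
  · rw [h1]; exact exitProb_nonneg _ _
  · rw [h2]; exact sub_nonneg.2 (exitProb_le_one hα (by omega))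
  · intro x h1 h2
    simp [transition, h1, h2]

lemma stepMean_interior {α : ℝ} {f : ℕ × ℕ → ℝ} (hf : ∀ z, 0 ≤ f z) (x y : ℕ) :
    stepMean α (fun z => ENNReal.ofReal (f z)) (x + 1, y + 1) =
      ENNReal.ofReal ((f (x + 2, y + 1) + f (x, y + 1) + f (x + 1, y + 2) + f (x + 1, y)) / 4) := by
  have h4 : ENNReal.ofReal 4⁻¹ = 4⁻¹ := by
    rw [ENNReal.ofReal_inv_of_pos (by norm_num)]; norm_num
  rw [stepMean, tsum_eq_sum (s := {(x + 2, y + 1), (x, y + 1), (x + 1, y + 2), (x + 1, y)})]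
  · rw [Finset.sum_insert (by simp), Finset.sum_insert (by simp), Finset.sum_pair (by simp)]
    simp only [transition, true_or, or_true, if_true]
    have e : (f (x + 2, y + 1) + f (x, y + 1) + f (x + 1, y + 2) + f (x + 1, y)) / 4 =
        1 / 4 * f (x + 2, y + 1) + (1 / 4 * f (x, y + 1) + (1 / 4 * f (x + 1, y + 2) +
          1 / 4 * f (x + 1, y))) := by ring
    have hp : ∀ z, 0 ≤ 1 / 4 * f z := fun z => by have := hf z; positivity
    simp only [← ENNReal.ofReal_mul (show (0 : ℝ) ≤ 1 / 4 by norm_num)]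
    rw [← ENNReal.ofReal_add (hp _) (hp _), ← ENNReal.ofReal_add (hp _) (add_nonneg (hp _) (hp _)),
      ← ENNReal.ofReal_add (hp _) (add_nonneg (hp _) (add_nonneg (hp _) (hp _))), e]
  · intro w hw
    simp only [Finset.mem_insert, Finset.mem_singleton] at hw
    simp [transition, hw]

/-- The function equal to `a` of the distance to the origin on the axes, and to `b` of the sum of
the coordinates elsewhere. -/
noncomputable def axisFun (a b : ℕ → ℝ) (z : ℕ × ℕ) : ℝ :=
  if z.1 * z.2 = 0 then a (z.1 + z.2) else b (z.1 + z.2)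

/-- A step from an axis raises the coordinate sum by one whether the walk stays or leaves, so both
outcomes are read at `i + 1`. The origin stays on the axes with certainty, hence the separate
condition `h0`. -/
lemma stepMean_axisFun_le {α : ℝ} (hα : 0 < α) {a b c : ℕ → ℝ} (ha : ∀ i, 0 ≤ a i)
    (hb : ∀ i, 0 ≤ b i) (h0 : a 1 ≤ c 0)
    (h : ∀ i, 1 ≤ i → exitProb α i * b (i + 1) + (1 - exitProb α i) * a (i + 1) ≤ c i)
    {z : ℕ × ℕ} (hz : z ∈ axes) :
    stepMean α (fun z => ENNReal.ofReal (axisFun a b z)) z ≤ ENNReal.ofReal (c (z.1 + z.2)) := by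
  have hp : ∀ z, 0 ≤ axisFun a b z := fun z => by
    unfold axisFun; split_ifs; exacts [ha _, hb _]
  obtain ⟨x, y⟩ := z
  have hz' : x * y = 0 := hz
  rcases x with _ | x
  · rcases y with _ | y
    · rw [stepMean_origin hp]
      refine ENNReal.ofReal_le_ofReal ?_
      simp only [axisFun]
      norm_num
      linarith
    · rw [stepMean_snd_axis hα hp]
      refine ENNReal.ofReal_le_ofReal ?_
      have := h (y + 1) (by omega)
      simp only [axisFun]
      simpa [add_comm, add_left_comm, add_assoc] using this
  · obtain rfl : y = 0 := by simpa using hz'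
    rw [stepMean_fst_axis hα hp]
    refine ENNReal.ofReal_le_ofReal ?_
    have := h (x + 1) (by omega)
    simp only [axisFun]
    simpa [add_comm, add_left_comm, add_assoc] using this

/-! ### Supersolutions for the moments of the time on an axis. -/

lemma add_one_rpow_le {β y : ℝ} (hβ : 0 ≤ β) (hβ1 : β ≤ 1) (hy : 1 ≤ y) :
    (y + 1) ^ β ≤ y ^ β + β := by
  have hy0 : 0 < y := by linarith
  have h1 : (y + 1) ^ β = y ^ β * (1 + 1 / y) ^ β := by
    rw [← Real.mul_rpow hy0.le (by positivity)]
    congr 1; field_simp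
  have hy1 : 0 < 1 / y := by positivity
  have h2 : (1 + 1 / y) ^ β ≤ 1 + β * (1 / y) :=
    rpow_one_add_le_one_add_mul_self (by linarith) hβ hβ1
  have h3 : y ^ β ≤ y := by
    simpa using Real.rpow_le_rpow_of_exponent_le hy hβ1
  rw [h1]
  calc y ^ β * (1 + 1 / y) ^ β ≤ y ^ β * (1 + β * (1 / y)) := by gcongr
    _ = y ^ β + β * (y ^ β / y) := by ring
    _ ≤ y ^ β + β * 1 := by
      gcongr
      exact (div_le_one hy0).2 h3
    _ = _ := by ring

/-- Bounds for the first two moments of the time spent on the axis, as a function of the point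
of entry. -/
lemma exists_axisTime_bounds {α : ℝ} (hα₀ : 0 < α) (hα : α < 1 / 2) :
    ∃ (C : ℝ) (v w : ℕ → ℝ), 0 ≤ C ∧ (∀ i, 0 ≤ v i) ∧ (∀ i, 0 ≤ w i) ∧
      1 + v 1 ≤ v 0 ∧ 1 + 2 * v 1 + w 1 ≤ w 0 ∧
      (∀ i, 1 ≤ i → 1 + (1 - exitProb α i) * v (i + 1) ≤ v i) ∧
      (∀ i, 1 ≤ i → 1 + (1 - exitProb α i) * (2 * v (i + 1) + w (i + 1)) ≤ w i) ∧
      (∀ i : ℕ, v i ≤ C * (1 + (i : ℝ) ^ α)) ∧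
      (∀ i : ℕ, w i ≤ C * (1 + (i : ℝ) ^ (2 * α))) := by
  -- Shifting by `c` makes the powers `u` below at least `4`, which absorbs the bounded increment of
  -- the power `2 * α`.
  obtain ⟨c, hc⟩ : ∃ c : ℕ, (4 : ℝ) ≤ (c : ℝ) ^ α := by
    obtain ⟨c, hc⟩ := exists_nat_ge ((4 : ℝ) ^ (1 / α))
    refine ⟨c, ?_⟩
    have := Real.rpow_le_rpow (by positivity) hc hα₀.le
    rwa [← Real.rpow_mul (by norm_num), one_div_mul_cancel hα₀.ne', Real.rpow_one] at this
  -- Exit probability times `(y + 1) ^ α` is at least `1 / 2`, while one step outwards raises the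
  -- power by at most `α`; `K` makes the net gain at least one.
  obtain ⟨K, hK0, hK⟩ : ∃ K : ℝ, 0 ≤ K ∧ 1 ≤ K * (1 / 2 - α) := by
    have : 0 < 1 / 2 - α := by linarith
    exact ⟨1 / (1 / 2 - α), by positivity, by rw [one_div_mul_cancel this.ne']⟩
  -- Of the gain `L * u / 2`, one half absorbs the increment error and the other, `L * u / 4`,
  -- covers `1 + 2 * K * u`.
  set L : ℝ := 4 * (1 + 2 * K) with hL
  have hL0 : 0 ≤ L := by positivity
  let v : ℕ → ℝ := fun i => if i = 0 then 1 + K * ((1 : ℕ) + c : ℝ) ^ α else K * (i + c : ℝ) ^ α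
  let w : ℕ → ℝ := fun i => if i = 0 then 1 + 2 * (K * ((1 : ℕ) + c : ℝ) ^ α) +
    L * ((1 : ℕ) + c : ℝ) ^ (2 * α) else L * (i + c : ℝ) ^ (2 * α)
  have hv : ∀ i, 1 ≤ i → v i = K * (i + c : ℝ) ^ α := fun i hi => if_neg (by omega)
  have hw : ∀ i, 1 ≤ i → w i = L * (i + c : ℝ) ^ (2 * α) := fun i hi => if_neg (by omega)
  have hv0 : v 0 = 1 + v 1 := by rw [hv 1 le_rfl]; exact if_pos rfl
  have hw0 : w 0 = 1 + 2 * v 1 + w 1 := by rw [hv 1 le_rfl, hw 1 le_rfl]; exact if_pos rfl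
  have hvn : ∀ i, 0 ≤ v i := fun i => by simp only [v]; split_ifs <;> positivity
  have hwn : ∀ i, 0 ≤ w i := fun i => by simp only [w]; split_ifs <;> positivity
  have hgrow : ∀ {β : ℝ} (_ : 0 ≤ β) (_ : β ≤ 1) (i : ℕ),
      (i + c : ℝ) ^ β ≤ (1 + (c : ℝ) ^ β) * (1 + (i : ℝ) ^ β) := by
    intro β h0 h1 i
    have h2 : (i + c : ℝ) ^ β ≤ (i : ℝ) ^ β + (c : ℝ) ^ β :=
      Real.rpow_add_le_add_rpow (by positivity) (by positivity) h0 h1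
    have h3 : 0 ≤ (c : ℝ) ^ β * (i : ℝ) ^ β := by positivity
    nlinarith
  set C : ℝ := v 0 + w 0 + K * (1 + (c : ℝ) ^ α) + L * (1 + (c : ℝ) ^ (2 * α)) with hC
  have hKc : 0 ≤ K * (1 + (c : ℝ) ^ α) := by positivity
  have hLc : 0 ≤ L * (1 + (c : ℝ) ^ (2 * α)) := by positivity
  have hbase : ∀ i : ℕ, 1 ≤ i → (1 : ℝ) ≤ (i + c : ℝ) := fun i hi => by
    have : (1 : ℝ) ≤ i := by exact_mod_cast hi
    have : (0 : ℝ) ≤ c := by positivity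
    linarith
  refine ⟨C, v, w, ?_, hvn, hwn, hv0.ge, hw0.ge, ?_, ?_, ?_, ?_⟩
  · have := hvn 0; have := hwn 0; linarith
  · intro i hi
    have hi' : (1 : ℝ) ≤ i := by exact_mod_cast hi
    rw [hv i hi, hv (i + 1) (by omega), show ((i + 1 : ℕ) + c : ℝ) = i + c + 1 by push_cast; ring]
    set y : ℝ := i + c with hy
    have h1 : (y + 1) ^ α ≤ y ^ α + α := add_one_rpow_le hα₀.le (by linarith) (hbase i hi)
    have h2 : 1 / 2 ≤ exitProb α i * (y + 1) ^ α := by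
      have h3 : (i : ℝ) ^ α ≤ (y + 1) ^ α :=
        Real.rpow_le_rpow (by positivity)
          (by have : (0 : ℝ) ≤ c := by positivity
              linarith) hα₀.le
      have h4 : 0 < (i : ℝ) ^ α := by positivity
      rw [exitProb, div_mul_eq_mul_div, one_mul, le_div_iff₀ (by positivity)]
      linarith
    nlinarith
  · intro i hi
    have hi' : (1 : ℝ) ≤ i := by exact_mod_cast hi
    rw [hw i hi, hw (i + 1) (by omega), hv (i + 1) (by omega),
      show ((i + 1 : ℕ) + c : ℝ) = i + c + 1 by push_cast; ring]
    have hc0 : (0 : ℝ) ≤ c := by positivity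
    set y : ℝ := i + c with hy
    have hy0 : 0 ≤ y + 1 := by linarith
    have h1 : (y + 1) ^ (2 * α) ≤ y ^ (2 * α) + 2 * α :=
      add_one_rpow_le (by linarith) (by linarith) (hbase i hi)
    set u : ℝ := (y + 1) ^ α with hu
    have hu2 : (y + 1) ^ (2 * α) = u * u := by
      rw [hu, ← Real.rpow_add (by linarith)]; ring_nf
    have hu4 : 4 ≤ u := hc.trans (Real.rpow_le_rpow hc0 (by linarith) hα₀.le)
    have h3 : (i : ℝ) ^ α ≤ u := Real.rpow_le_rpow (by positivity) (by linarith) hα₀.le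
    have h4 : 0 < (i : ℝ) ^ α := by positivity
    have h2 : 1 / 2 ≤ exitProb α i * u := by
      rw [exitProb, div_mul_eq_mul_div, one_mul, le_div_iff₀ (by positivity)]
      linarith
    rw [hu2] at h1 ⊢
    have h5 : 0 ≤ exitProb α i * (2 * (K * u)) :=
      mul_nonneg (exitProb_nonneg α i) (by positivity)
    have h6 : L * (u * u) ≤ L * (y ^ (2 * α) + 1) :=
      mul_le_mul_of_nonneg_left (by linarith) hL0
    have h7 : L * (1 / 2 * u) ≤ L * (exitProb α i * u * u) := by gcongr
    have h8 : L * u * (1 / 4) ≤ L * (1 / 2 * u) - L := by nlinarith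
    have h9 : 1 + 2 * (K * u) ≤ L * u * (1 / 4) := by rw [hL]; nlinarith
    nlinarith
  · intro i
    rcases Nat.eq_zero_or_pos i with rfl | hi
    · have h1 : C ≤ C * (1 + ((0 : ℕ) : ℝ) ^ α) := by
        have : 0 ≤ ((0 : ℕ) : ℝ) ^ α := by positivity
        have hC0 : 0 ≤ C := by have := hvn 0; have := hwn 0; linarith
        nlinarith
      have := hwn 0; linarith
    · rw [hv i hi]
      calc K * (i + c : ℝ) ^ α ≤ K * ((1 + (c : ℝ) ^ α) * (1 + (i : ℝ) ^ α)) := by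
            gcongr; exact hgrow hα₀.le (by linarith) i
        _ = (K * (1 + (c : ℝ) ^ α)) * (1 + (i : ℝ) ^ α) := by ring
        _ ≤ _ := by
          gcongr
          have := hvn 0; have := hwn 0; linarith
  · intro i
    rcases Nat.eq_zero_or_pos i with rfl | hi
    · have h1 : C ≤ C * (1 + ((0 : ℕ) : ℝ) ^ (2 * α)) := by
        have : 0 ≤ ((0 : ℕ) : ℝ) ^ (2 * α) := by positivity
        have hC0 : 0 ≤ C := by have := hvn 0; have := hwn 0; linarith
        nlinarith
      have := hvn 0; linarith
    · rw [hw i hi]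
      calc L * (i + c : ℝ) ^ (2 * α) ≤ L * ((1 + (c : ℝ) ^ (2 * α)) * (1 + (i : ℝ) ^ (2 * α))) := by
            gcongr; exact hgrow (by linarith) (by linarith) i
        _ = (L * (1 + (c : ℝ) ^ (2 * α))) * (1 + (i : ℝ) ^ (2 * α)) := by ring
        _ ≤ _ := by
          gcongr
          have := hvn 0; have := hwn 0; linarith

/-! ### Optional stopping along the visits. -/

/-- The sum of the coordinates, as an extended nonnegative real number. -/
noncomputable def coordSum (z : ℕ × ℕ) : ℝ≥0∞ := ENNReal.ofReal ((z.1 + z.2 : ℕ) : ℝ)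

section

variable {Ω : Type*} [MeasurableSpace Ω] {μ : Measure Ω} {α : ℝ} {z₀ : ℕ × ℕ}
  {Z : ℕ → Ω → ℕ × ℕ}

/-- Mean of `g` at the random time `τ`, restricted to the event that `τ` is finite. -/
noncomputable def stoppedMean (μ : Measure Ω) (Z : ℕ → Ω → ℕ × ℕ) (τ : (ℕ → ℕ × ℕ) → ℕ∞)
    (g : ℕ × ℕ → ℝ≥0∞) : ℝ≥0∞ :=
  ∑' k : ℕ, ∫⁻ ω in {ω | τ (fun n => Z n ω) = k}, g (Z k ω) ∂μ

lemma stoppedMean_mono {τ : (ℕ → ℕ × ℕ) → ℕ∞} {g h : ℕ × ℕ → ℝ≥0∞} (hgh : ∀ z, g z ≤ h z) :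
    stoppedMean μ Z τ g ≤ stoppedMean μ Z τ h :=
  ENNReal.tsum_le_tsum fun _ => lintegral_mono fun _ => hgh _

/-- Only an inequality, since `τ` may be infinite with positive probability. -/
lemma IsAxisDrivenWalk.stoppedMean_linear_le [IsProbabilityMeasure μ]
    (hZ : IsAxisDrivenWalk α z₀ μ Z) {τ : (ℕ → ℕ × ℕ) → ℕ∞} (hτ : Causal τ) {a b : ℝ}
    (ha : 0 ≤ a) (hb : 0 ≤ b) :
    stoppedMean μ Z τ (fun z => ENNReal.ofReal (a + b * ((z.1 + z.2 : ℕ) : ℝ))) ≤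
      ENNReal.ofReal a + ENNReal.ofReal b * stoppedMean μ Z τ coordSum := by
  have hterm : ∀ k : ℕ, ∫⁻ ω in {ω | τ (fun n => Z n ω) = k},
      ENNReal.ofReal (a + b * (((Z k ω).1 + (Z k ω).2 : ℕ) : ℝ)) ∂μ =
      ENNReal.ofReal a * μ {ω | τ (fun n => Z n ω) = k} +
        ENNReal.ofReal b * ∫⁻ ω in {ω | τ (fun n => Z n ω) = k}, coordSum (Z k ω) ∂μ := by
    intro k
    have hm : Measurable fun ω => coordSum (Z k ω) :=
      (measurable_of_countable coordSum).comp (hZ.measurable k)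
    rw [← setLIntegral_const, ← lintegral_const_mul _ hm, ← lintegral_add_left measurable_const]
    refine lintegral_congr fun ω => ?_
    rw [ENNReal.ofReal_add ha (by positivity), ENNReal.ofReal_mul hb, coordSum]
  have hmass : ∑' k : ℕ, μ {ω | τ (fun n => Z n ω) = k} ≤ 1 := by
    rw [← measure_iUnion]
    · exact prob_le_one
    · intro i j hij
      refine Set.disjoint_left.2 fun ω hi hj => hij ?_
      have hi' : τ (fun n => Z n ω) = i := hi
      have hj' : τ (fun n => Z n ω) = j := hj
      rw [hi'] at hj'
      exact_mod_cast hj'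
    · exact fun k => hZ.measurableSet (hτ k)
  unfold stoppedMean
  simp only [hterm]
  rw [ENNReal.tsum_add, ENNReal.tsum_mul_left, ENNReal.tsum_mul_left]
  gcongr
  exact mul_le_of_le_one_right' hmass

/-- Optional stopping at the first visit to `B` after `τ`, for a function which is superharmonic
off `B` and may depend on the time elapsed since `τ`. -/
lemma IsAxisDrivenWalk.tsum_tsum_nextVisit_le [IsProbabilityMeasure μ]
    (hZ : IsAxisDrivenWalk α z₀ μ Z) {τ : (ℕ → ℕ × ℕ) → ℕ∞} (hτ : Causal τ) {B : Set (ℕ × ℕ)}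
    (hτB : ∀ᵐ ω ∂μ, ∀ k : ℕ, τ (fun n => Z n ω) = k → Z k ω ∉ B) (f : ℕ → ℕ × ℕ → ℝ≥0∞)
    (hf : ∀ t, ∀ z ∉ B, stepMean α (f (t + 1)) z ≤ f t z) :
    ∑' k : ℕ, ∑' n : ℕ, ∫⁻ ω in {ω | τ (fun i => Z i ω) = k ∧
        nextVisit (fun i => Z i ω) B (τ fun i => Z i ω) = n}, f (n - k) (Z n ω) ∂μ ≤
      stoppedMean μ Z τ (f 0) := by
  refine ENNReal.tsum_le_tsum fun k => ?_
  have hS : DeterminedBy k ({s | τ s = k} ∩ {s | s k ∈ Bᶜ}) :=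
    (hτ k).inter (determinedBy_eval le_rfl _)
  have h := hZ.tsum_hitting_le hS (B := B) (fun s hs => hs.2) (fun n => f (n - k))
    (fun n hn z hz => by
      rw [show n + 1 - k = n - k + 1 by omega]
      exact hf _ z hz)
  calc _ ≤ ∑' n, ∫⁻ ω in {ω | (fun i => Z i ω) ∈
            hitting ({s | τ s = k} ∩ {s | s k ∈ Bᶜ}) B k n}, f (n - k) (Z n ω) ∂μ := by
        refine ENNReal.tsum_le_tsum fun n => lintegral_mono_set' ?_
        filter_upwards [hτB] with ω hω hmem
        refine ⟨⟨hmem.1, hω k hmem.1⟩, ?_⟩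
        have := hmem.2
        rwa [hmem.1] at this
    _ ≤ _ := h
    _ ≤ _ := by
        simp only [Nat.sub_self]
        exact lintegral_mono_set fun ω hω => hω.1

lemma IsAxisDrivenWalk.stoppedMean_nextVisit_le [IsProbabilityMeasure μ]
    (hZ : IsAxisDrivenWalk α z₀ μ Z) {τ : (ℕ → ℕ × ℕ) → ℕ∞} (hτ : Causal τ) {B : Set (ℕ × ℕ)}
    (hτB : ∀ᵐ ω ∂μ, ∀ k : ℕ, τ (fun n => Z n ω) = k → Z k ω ∉ B) (f : ℕ × ℕ → ℝ≥0∞)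
    (hf : ∀ z ∉ B, stepMean α f z ≤ f z) :
    stoppedMean μ Z (fun s => nextVisit s B (τ s)) f ≤ stoppedMean μ Z τ f := by
  refine le_trans ?_ (hZ.tsum_tsum_nextVisit_le hτ hτB (fun _ => f) fun _ => hf)
  -- Grouped by the time of the visit, each event is covered by the possible finite values of `τ`.
  rw [ENNReal.tsum_comm]
  refine ENNReal.tsum_le_tsum fun n => ?_
  refine le_trans (lintegral_mono_set fun ω hω => ?_) (lintegral_iUnion_le _ _)
  have hω' := (nextVisit_eq_coe_iff _ _ _ _).1 hω
  obtain ⟨k, hk⟩ := ENat.ne_top_iff_exists.1 (ne_top_of_lt hω'.1)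
  exact Set.mem_iUnion.2 ⟨k, hk.symm, hω⟩

lemma eta_mem_axes (s : ℕ → ℕ × ℕ) (j k : ℕ) (h : eta s (j + 1) = k) : s k ∈ axes :=
  ((nextVisit_eq_coe_iff _ _ _ _).1 h).2.1

lemma IsAxisDrivenWalk.ae_rho_notMem_axes [IsProbabilityMeasure μ]
    (hZ : IsAxisDrivenWalk α (1, 1) μ Z) (j : ℕ) :
    ∀ᵐ ω ∂μ, ∀ k : ℕ, rho (fun n => Z n ω) j = k → Z k ω ∉ axes := by
  cases j with
  | zero =>
    filter_upwards [hZ.ae_zero] with ω hω k hk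
    have hk0 : k = 0 := by
      have : (0 : ℕ∞) = k := hk
      exact_mod_cast this.symm
    rw [hk0, hω]
    simp [axes]
  | succ j =>
    exact Eventually.of_forall fun ω k hk => ((nextVisit_eq_coe_iff _ _ _ _).1 hk).2.1

lemma stepMean_coordSum_interior {z : ℕ × ℕ} (hz : z ∉ axes) :
    stepMean α coordSum z = coordSum z := by
  obtain ⟨x, y⟩ := z
  rcases x with _ | x
  · exact absurd (by simp [axes]) hz
  rcases y with _ | y
  · exact absurd (by simp [axes]) hz
  have := stepMean_interior (α := α) (f := fun z => ((z.1 + z.2 : ℕ) : ℝ))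
    (fun z => Nat.cast_nonneg _) x y
  unfold coordSum
  rw [this]
  congr 1
  push_cast
  ring

/-- The supermartingale inequality suffices, so neither uniform integrability nor finiteness of
`eta` has to be known here. -/
lemma IsAxisDrivenWalk.stoppedMean_eta_le [IsProbabilityMeasure μ]
    (hZ : IsAxisDrivenWalk α (1, 1) μ Z) (j : ℕ) :
    stoppedMean μ Z (fun s => eta s (j + 1)) coordSum ≤
      stoppedMean μ Z (fun s => rho s j) coordSum :=
  hZ.stoppedMean_nextVisit_le (causal_rho j) (hZ.ae_rho_notMem_axes j) coordSum
    fun _ hz => (stepMean_coordSum_interior hz).le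

lemma IsAxisDrivenWalk.stoppedMean_rho_zero_le [IsProbabilityMeasure μ]
    (hZ : IsAxisDrivenWalk α (1, 1) μ Z) :
    stoppedMean μ Z (fun s => rho s 0) coordSum ≤ 2 := by
  rw [stoppedMean, tsum_eq_single 0]
  · refine (setLIntegral_le_lintegral _ _).trans ?_
    rw [lintegral_congr_ae (g := fun _ => 2)]
    · simp
    · filter_upwards [hZ.ae_zero] with ω hω
      rw [hω]; norm_num [coordSum]
  · intro k hk
    have : {ω | rho (fun n => Z n ω) 0 = (k : ℕ∞)} = ∅ := by
      ext ω
      simp only [rho, Set.mem_ofPred_eq, Set.mem_empty_iff_false, iff_false]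
      intro h
      exact hk (by exact_mod_cast h.symm)
    rw [this]; simp

lemma IsAxisDrivenWalk.stoppedMean_rho_succ_le [IsProbabilityMeasure μ]
    (hZ : IsAxisDrivenWalk α z₀ μ Z) (hα : 0 < α) {v : ℕ → ℝ} (hv : ∀ i, 0 ≤ v i)
    (hv0 : 1 + v 1 ≤ v 0) (hv1 : ∀ i, 1 ≤ i → 1 + (1 - exitProb α i) * v (i + 1) ≤ v i) (j : ℕ) :
    stoppedMean μ Z (fun s => rho s (j + 1)) coordSum ≤
      stoppedMean μ Z (fun s => eta s (j + 1))
        (fun z => ENNReal.ofReal (((z.1 + z.2 : ℕ) : ℝ) + v (z.1 + z.2))) := by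
  -- On an axis, `v` bounds the mean remaining time, each unit of which adds one to the coordinate
  -- sum; off the axes nothing remains to be added.
  let F : ℕ × ℕ → ℝ := axisFun (fun i => (i : ℝ) + v i) (fun i => (i : ℝ))
  have h := hZ.stoppedMean_nextVisit_le (causal_eta j) (B := axesᶜ)
    (Eventually.of_forall fun ω k hk hB => hB (eta_mem_axes _ j k hk))
    (fun z => ENNReal.ofReal (F z)) (fun z hz => by
      have hz' : z ∈ axes := by simpa using hz
      have hFz : F z = ((z.1 + z.2 : ℕ) : ℝ) + v (z.1 + z.2) := if_pos hz'
      rw [hFz]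
      refine stepMean_axisFun_le hα (c := fun i => (i : ℝ) + v i)
        (fun i => add_nonneg (Nat.cast_nonneg _) (hv i)) (fun i => Nat.cast_nonneg _) ?_ ?_ hz'
      · push_cast; linarith
      · intro i hi
        have := hv1 i hi
        push_cast
        linarith)
  calc _ ≤ stoppedMean μ Z (fun s => rho s (j + 1)) (fun z => ENNReal.ofReal (F z)) :=
        stoppedMean_mono fun z => by
          refine ENNReal.ofReal_le_ofReal ?_
          simp only [F, axisFun]
          split_ifs
          · have := hv (z.1 + z.2); linarith
          · exact le_rfl
    _ ≤ _ := h
    _ ≤ _ := stoppedMean_mono fun z => by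
          refine ENNReal.ofReal_le_ofReal ?_
          simp only [F, axisFun]
          split_ifs
          · exact le_rfl
          · have := hv (z.1 + z.2); linarith

/-- A superharmonic function of the elapsed time `t` and the position, which dominates `t ^ 2`. -/
noncomputable def sqTimeFun (v w : ℕ → ℝ) (t : ℕ) : ℕ × ℕ → ℝ :=
  axisFun (fun i => (t : ℝ) ^ 2 + 2 * t * v i + w i) (fun _ => (t : ℝ) ^ 2)

lemma sq_le_sqTimeFun {v w : ℕ → ℝ} (hv : ∀ i, 0 ≤ v i) (hw : ∀ i, 0 ≤ w i) (t : ℕ) (z : ℕ × ℕ) :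
    (t : ℝ) ^ 2 ≤ sqTimeFun v w t z := by
  simp only [sqTimeFun, axisFun]
  split_ifs
  · have := mul_nonneg (Nat.cast_nonneg (α := ℝ) t) (hv (z.1 + z.2))
    have := hw (z.1 + z.2)
    linarith
  · exact le_rfl

lemma sqTimeFun_zero_le {v w : ℕ → ℝ} (hw : ∀ i, 0 ≤ w i) (z : ℕ × ℕ) :
    sqTimeFun v w 0 z ≤ w (z.1 + z.2) := by
  simp only [sqTimeFun, axisFun]
  split_ifs
  · simp
  · simpa using hw _

/-- The function mimics the mean of `(t + T) ^ 2` with `T` the remaining time on the axis: the terms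
linear in `t` use the inequality for `v`, the others that for `w`. -/
lemma stepMean_sqTimeFun_le (hα : 0 < α) {v w : ℕ → ℝ} (hv : ∀ i, 0 ≤ v i) (hw : ∀ i, 0 ≤ w i)
    (hv0 : 1 + v 1 ≤ v 0) (hw0 : 1 + 2 * v 1 + w 1 ≤ w 0)
    (hv1 : ∀ i, 1 ≤ i → 1 + (1 - exitProb α i) * v (i + 1) ≤ v i)
    (hw1 : ∀ i, 1 ≤ i → 1 + (1 - exitProb α i) * (2 * v (i + 1) + w (i + 1)) ≤ w i)
    (t : ℕ) {z : ℕ × ℕ} (hz : z ∈ axes) :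
    stepMean α (fun z => ENNReal.ofReal (sqTimeFun v w (t + 1) z)) z ≤
      ENNReal.ofReal (sqTimeFun v w t z) := by
  have ht : (0 : ℝ) ≤ t := Nat.cast_nonneg t
  have hFz : sqTimeFun v w t z = (t : ℝ) ^ 2 + 2 * t * v (z.1 + z.2) + w (z.1 + z.2) := if_pos hz
  rw [hFz]
  refine stepMean_axisFun_le hα (c := fun i => (t : ℝ) ^ 2 + 2 * t * v i + w i) ?_ ?_ ?_ ?_ hz
  · intro i
    have := hv i; have := hw i
    positivity
  · intro i; positivity
  · push_cast
    have := mul_le_mul_of_nonneg_left hv0 ht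
    linarith
  · intro i hi
    have h1 := mul_le_mul_of_nonneg_left (hv1 i hi) ht
    have h2 := hw1 i hi
    push_cast
    linarith

lemma IsAxisDrivenWalk.tsum_sq_axisTime_le [IsProbabilityMeasure μ]
    (hZ : IsAxisDrivenWalk α z₀ μ Z) (hα : 0 < α) {v w : ℕ → ℝ}
    (hv : ∀ i, 0 ≤ v i) (hw : ∀ i, 0 ≤ w i)
    (hv0 : 1 + v 1 ≤ v 0) (hw0 : 1 + 2 * v 1 + w 1 ≤ w 0)
    (hv1 : ∀ i, 1 ≤ i → 1 + (1 - exitProb α i) * v (i + 1) ≤ v i)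
    (hw1 : ∀ i, 1 ≤ i → 1 + (1 - exitProb α i) * (2 * v (i + 1) + w (i + 1)) ≤ w i) (j : ℕ) :
    ∑' k : ℕ, ∑' n : ℕ, ∫⁻ _ in {ω | eta (fun i => Z i ω) (j + 1) = k ∧
        rho (fun i => Z i ω) (j + 1) = n}, ENNReal.ofReal (((n - k : ℕ) : ℝ) ^ 2) ∂μ ≤
      stoppedMean μ Z (fun s => eta s (j + 1)) (fun z => ENNReal.ofReal (w (z.1 + z.2))) := by
  have h := hZ.tsum_tsum_nextVisit_le (causal_eta j) (B := axesᶜ)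
    (Eventually.of_forall fun ω k hk hB => hB (eta_mem_axes _ j k hk))
    (fun t z => ENNReal.ofReal (sqTimeFun v w t z)) (fun t z hz =>
      stepMean_sqTimeFun_le hα hv hw hv0 hw0 hv1 hw1 t (by simpa using hz))
  refine le_trans ?_ (h.trans (stoppedMean_mono fun z =>
    ENNReal.ofReal_le_ofReal (sqTimeFun_zero_le hw z)))
  exact ENNReal.tsum_le_tsum fun k => ENNReal.tsum_le_tsum fun n => lintegral_mono fun ω =>
    ENNReal.ofReal_le_ofReal (sq_le_sqTimeFun hv hw _ _)

end

/-! ### Growth of the mean position. -/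

/-- A tangent-type bound for a concave power. -/
lemma rpow_le_add_mul {β l x : ℝ} (hβ : 0 ≤ β) (hβ1 : β ≤ 1) (hl : 0 < l) (hx : 0 ≤ x) :
    x ^ β ≤ l ^ β + l ^ (β - 1) * x := by
  rcases le_total x l with h | h
  · have h1 : x ^ β ≤ l ^ β := Real.rpow_le_rpow hx h hβ
    have h2 : 0 ≤ l ^ (β - 1) * x := by positivity
    linarith
  · have hx0 : 0 < x := hl.trans_le h
    have h1 : x ^ β = x ^ (β - 1) * x := by
      rw [← Real.rpow_add_one hx0.ne']; ring_nf
    have h2 : x ^ (β - 1) ≤ l ^ (β - 1) := Real.rpow_le_rpow_of_nonpos hl h (by linarith)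
    have h3 : 0 ≤ l ^ β := by positivity
    rw [h1]
    have := mul_le_mul_of_nonneg_right h2 hx
    linarith

section

variable {Ω : Type*} [MeasurableSpace Ω] {μ : Measure Ω} {α : ℝ} {z₀ : ℕ × ℕ}
  {Z : ℕ → Ω → ℕ × ℕ}

/-- A substitute for Jensen's inequality: linearising the power at a free scale `l` requires only
the first moment. -/
lemma IsAxisDrivenWalk.stoppedMean_le_of_rpow_le [IsProbabilityMeasure μ]
    (hZ : IsAxisDrivenWalk α z₀ μ Z) {τ : (ℕ → ℕ × ℕ) → ℕ∞} (hτ : Causal τ) {β C b l m : ℝ}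
    {g : ℕ → ℝ} (hβ : 0 ≤ β) (hβ1 : β ≤ 1) (hC : 0 ≤ C) (hb : 0 ≤ b) (hl : 0 < l) (hm : 0 ≤ m)
    (hg : ∀ i : ℕ, g i ≤ b * i + C * (1 + (i : ℝ) ^ β))
    (hτm : stoppedMean μ Z τ coordSum ≤ ENNReal.ofReal m) :
    stoppedMean μ Z τ (fun z => ENNReal.ofReal (g (z.1 + z.2))) ≤
      ENNReal.ofReal (C * (1 + l ^ β) + (b + C * l ^ (β - 1)) * m) := by
  have h1 := hZ.stoppedMean_linear_le hτ (a := C * (1 + l ^ β)) (b := b + C * l ^ (β - 1))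
    (by positivity) (by positivity)
  refine (stoppedMean_mono fun z => ENNReal.ofReal_le_ofReal ?_).trans (h1.trans ?_)
  · have h2 := rpow_le_add_mul hβ hβ1 hl (Nat.cast_nonneg (α := ℝ) (z.1 + z.2))
    have h3 := mul_le_mul_of_nonneg_left h2 hC
    have h4 := hg (z.1 + z.2)
    linarith
  · rw [ENNReal.ofReal_add (p := C * (1 + l ^ β)) (by positivity) (by positivity),
      ENNReal.ofReal_mul (p := b + C * l ^ (β - 1)) (by positivity)]
    exact add_le_add le_rfl (mul_le_mul' le_rfl hτm)

/-- The mean position at the end of the `j`-th visit grows at most like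
`j ^ (1 / (1 - α))`. -/
lemma IsAxisDrivenWalk.exists_stoppedMean_rho_le [IsProbabilityMeasure μ]
    (hZ : IsAxisDrivenWalk α (1, 1) μ Z) (hα₀ : 0 < α) (hα : α < 1 / 2) :
    ∃ A : ℝ, 0 ≤ A ∧ ∀ j : ℕ, stoppedMean μ Z (fun s => rho s j) coordSum ≤
      ENNReal.ofReal (A * ((j : ℝ) + 1) ^ (1 / (1 - α))) := by
  obtain ⟨C₀, v, w, hC₀, hv, -, hv0, -, hv1, -, hvC₀, -⟩ := exists_axisTime_bounds hα₀ hα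
  set C : ℝ := C₀ + 1 with hCdef
  have hC : 0 < C := by linarith
  have hvC : ∀ i : ℕ, v i ≤ C * (1 + (i : ℝ) ^ α) := fun i => (hvC₀ i).trans (by
    gcongr; linarith)
  -- Growth exponent of the recursion `x' = x ^ α`.
  set p : ℝ := 1 / (1 - α) with hp
  have h1α : 0 < 1 - α := by linarith
  have hp0 : 0 < p := by positivity
  have hpα : p * α = p - 1 := by rw [hp]; field_simp; ring
  have hpα1 : p * (α - 1) = -1 := by rw [mul_sub, hpα]; ring
  have hp1 : 1 ≤ p := by rw [hp, le_div_iff₀ h1α]; linarith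
  set B : ℝ := C + C * (2 * C) ^ (p - 1) with hB
  have hB0 : 0 ≤ B := by positivity
  refine ⟨2 + 2 * B, by positivity, fun j => ?_⟩
  induction j with
  | zero =>
    refine hZ.stoppedMean_rho_zero_le.trans ?_
    have : (2 : ℝ≥0∞) = ENNReal.ofReal 2 := by norm_num
    rw [this]
    refine ENNReal.ofReal_le_ofReal ?_
    norm_num
    exact hB0
  | succ j ih =>
    have hn : (1 : ℝ) ≤ (j : ℝ) + 1 := by have := Nat.cast_nonneg (α := ℝ) j; linarith
    set n : ℝ := (j : ℝ) + 1 with hndef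
    have hn0 : 0 < n := by linarith
    -- This scale gives `C * l ^ (α - 1) = 1 / (2 * n)`: the induction constant is then charged only
    -- half of what `(n + 1) ^ p - n ^ p` offers, and the other half pays for `B`.
    have hl0 : (0 : ℝ) < (2 * C * n) ^ p := by positivity
    have hD := (hZ.stoppedMean_eta_le j).trans ih
    have h1 := hZ.stoppedMean_le_of_rpow_le (causal_eta j) (g := fun i => (i : ℝ) + v i) (b := 1)
      hα₀.le (by linarith) hC.le zero_le_one hl0 (by positivity)
      (fun i => by have := hvC i; linarith) hD
    refine (hZ.stoppedMean_rho_succ_le hα₀ hv hv0 hv1 j).trans (h1.trans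
      (ENNReal.ofReal_le_ofReal ?_))
    rw [← Real.rpow_mul (by positivity), ← Real.rpow_mul (by positivity), hpα, hpα1,
      Real.rpow_neg_one, Real.mul_rpow (by positivity) hn0.le]
    push_cast
    rw [← hndef]
    set u : ℝ := n ^ (p - 1) with hu
    have hu1 : 1 ≤ u := Real.one_le_rpow hn (by linarith)
    have hnp : n ^ p = u * n := by
      rw [hu, ← Real.rpow_add_one hn0.ne']; ring_nf
    have hsucc : u * (n + 1) ≤ (n + 1) ^ p := by
      have h2 : (n + 1) ^ p = (n + 1) ^ (p - 1) * (n + 1) := by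
        rw [← Real.rpow_add_one (by positivity)]; ring_nf
      rw [h2]
      gcongr
      exact Real.rpow_le_rpow hn0.le (by linarith) (by linarith)
    have h3 : C * (2 * C * n)⁻¹ * (u * n) = u / 2 := by field_simp
    rw [hnp]
    calc C * (1 + (2 * C) ^ (p - 1) * u) + (1 + C * (2 * C * n)⁻¹) * ((2 + 2 * B) * (u * n))
        = C + C * (2 * C) ^ (p - 1) * u + (2 + 2 * B) * (u * n) +
          (2 + 2 * B) * (C * (2 * C * n)⁻¹ * (u * n)) := by ring
      _ = C + C * (2 * C) ^ (p - 1) * u + (2 + 2 * B) * (u * n) + (2 + 2 * B) * (u / 2) := by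
          rw [h3]
      _ ≤ C * u + C * (2 * C) ^ (p - 1) * u + (2 + 2 * B) * (u * n) + (2 + 2 * B) * (u / 2) := by
          gcongr; exact le_mul_of_one_le_right hC.le hu1
      _ = B * u + (1 + B) * u + (2 + 2 * B) * (u * n) := by rw [hB]; ring
      _ ≤ (2 + 2 * B) * (u * (n + 1)) := by nlinarith
      _ ≤ _ := by gcongr

/-! ### Almost sure finiteness of the visit times. -/

lemma setLIntegral_le_stoppedMean (τ : (ℕ → ℕ × ℕ) → ℕ∞) (g : ℕ × ℕ → ℝ≥0∞) (k : ℕ) :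
    ∫⁻ ω in {ω | τ (fun n => Z n ω) = k}, g (Z k ω) ∂μ ≤ stoppedMean μ Z τ g :=
  ENNReal.le_tsum k

lemma nextVisit_eq_top_avoiding {s : ℕ → ℕ × ℕ} {B : Set (ℕ × ℕ)} {k : ℕ}
    (h : nextVisit s B k = ⊤) (hk : s k ∉ B) (l : ℕ) (hl : k ≤ l) : s l ∉ B := by
  rcases hl.eq_or_lt with rfl | hlt
  · exact hk
  intro hB
  have h1 : nextVisit s B k ≤ l :=
    iInf₂_le (f := fun (i : ℕ) (_ : (k : ℕ∞) < (i : ℕ∞) ∧ s i ∈ B) => (i : ℕ∞)) l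
      ⟨by exact_mod_cast hlt, hB⟩
  rw [h] at h1
  exact ENat.natCast_ne_top l (top_le_iff.1 h1)

/-- The next visit of `B` after a finite time `τ` is almost surely finite, if the probability to
avoid `B` for a long time tends to zero. -/
lemma ae_nextVisit_ne_top {τ : (ℕ → ℕ × ℕ) → ℕ∞} {B : Set (ℕ × ℕ)}
    (hτB : ∀ᵐ ω ∂μ, ∀ k : ℕ, τ (fun n => Z n ω) = k → Z k ω ∉ B)
    (hτ : ∀ᵐ ω ∂μ, τ (fun n => Z n ω) ≠ ⊤)
    (h : ∀ k : ℕ, ∀ c : ℝ≥0∞, (∀ t, c ≤ μ {ω | (fun n => Z n ω) ∈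
      avoiding ({s | τ s = k} ∩ {s | s k ∈ Bᶜ}) B k t}) → c = 0) :
    ∀ᵐ ω ∂μ, nextVisit (fun n => Z n ω) B (τ fun n => Z n ω) ≠ ⊤ := by
  have hk : ∀ k : ℕ, ∀ᵐ ω ∂μ, ¬ (fun n => Z n ω) ∈
      ⋂ t, avoiding ({s | τ s = k} ∩ {s | s k ∈ Bᶜ}) B k t := by
    intro k
    rw [ae_iff]
    refine h k _ fun t => measure_mono fun ω hω => ?_
    have hω' : (fun n => Z n ω) ∈ ⋂ t, avoiding ({s | τ s = k} ∩ {s | s k ∈ Bᶜ}) B k t := by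
      simpa using hω
    exact Set.mem_iInter.1 hω' t
  filter_upwards [hτB, hτ, ae_all_iff.2 hk] with ω h1 h2 h3 htop
  obtain ⟨k, hk⟩ := ENat.ne_top_iff_exists.1 h2
  rw [← hk] at htop
  refine h3 k (Set.mem_iInter.2 fun t => ⟨⟨hk.symm, h1 k hk.symm⟩, fun l hl _ => ?_⟩)
  exact nextVisit_eq_top_avoiding htop (h1 k hk.symm) l hl

lemma IsAxisDrivenWalk.ae_rho_succ_ne_top [IsProbabilityMeasure μ]
    (hZ : IsAxisDrivenWalk α (1, 1) μ Z) (hα₀ : 0 < α) (hα : α < 1 / 2) (j : ℕ)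
    (hη : ∀ᵐ ω ∂μ, eta (fun n => Z n ω) (j + 1) ≠ ⊤) :
    ∀ᵐ ω ∂μ, rho (fun n => Z n ω) (j + 1) ≠ ⊤ := by
  obtain ⟨C, v, w, hC, hv, hw, hv0, hw0, hv1, hw1, -, hwC⟩ := exists_axisTime_bounds hα₀ hα
  obtain ⟨A, hA, hM⟩ := hZ.exists_stoppedMean_rho_le hα₀ hα
  refine ae_nextVisit_ne_top (τ := fun s => eta s (j + 1)) (B := axesᶜ)
    (Eventually.of_forall fun ω k hk hB => hB (eta_mem_axes _ j k hk)) hη fun k c hc => ?_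
  have hS : DeterminedBy k ({s | eta s (j + 1) = k} ∩ {s | s k ∈ axesᶜᶜ}) :=
    (causal_eta j k).inter (determinedBy_eval le_rfl _)
  have hW := hZ.stoppedMean_le_of_rpow_le (causal_eta j) (g := w) (β := 2 * α) (b := 0)
    (by linarith) (by linarith) hC le_rfl one_pos (by positivity)
    (fun i => by simpa using hwC i) ((hZ.stoppedMean_eta_le j).trans (hM j))
  set K : ℝ≥0∞ := stoppedMean μ Z (fun s => eta s (j + 1))
    (fun z => ENNReal.ofReal (w (z.1 + z.2))) with hK
  have hKtop : K ≠ ⊤ := ne_top_of_le_ne_top ENNReal.ofReal_ne_top hW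
  -- After elapsed time `t` on the axis the space-time function is at least `t ^ 2`, hence at least
  -- `t`, while its mean stays below `K`.
  have hbound : ∀ t : ℕ, (t : ℝ≥0∞) * c ≤ K := by
    intro t
    have h1 := hZ.setLIntegral_avoiding_le hS (B := axesᶜ) (fun s hs => hs.2)
      (fun n z => ENNReal.ofReal (sqTimeFun v w (n - k) z)) (fun n hn z hz => by
        rw [show n + 1 - k = n - k + 1 by omega]
        exact stepMean_sqTimeFun_le hα₀ hv hw hv0 hw0 hv1 hw1 _ (by simpa using hz)) t
    have h2 : ∫⁻ ω in {ω | (fun i => Z i ω) ∈ {s | eta s (j + 1) = k} ∩ {s | s k ∈ axesᶜᶜ}},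
        ENNReal.ofReal (sqTimeFun v w (k - k) (Z k ω)) ∂μ ≤ K := by
      refine le_trans ?_ (setLIntegral_le_stoppedMean _ _ k)
      refine (lintegral_mono_set fun ω hω => hω.1).trans (lintegral_mono fun ω => ?_)
      rw [Nat.sub_self]
      exact ENNReal.ofReal_le_ofReal (sqTimeFun_zero_le hw _)
    refine le_trans ?_ (h1.trans h2)
    calc (t : ℝ≥0∞) * c ≤ (t : ℝ≥0∞) * μ {ω | (fun n => Z n ω) ∈
          avoiding ({s | eta s (j + 1) = k} ∩ {s | s k ∈ axesᶜᶜ}) axesᶜ k t} := by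
          gcongr; exact hc t
      _ = ∫⁻ _ in {ω | (fun n => Z n ω) ∈
          avoiding ({s | eta s (j + 1) = k} ∩ {s | s k ∈ axesᶜᶜ}) axesᶜ k t}, (t : ℝ≥0∞) ∂μ := by
          rw [setLIntegral_const]
      _ ≤ _ := by
          refine lintegral_mono fun ω => ?_
          have h3 := sq_le_sqTimeFun hv hw t (Z (k + t) ω)
          rw [← ENNReal.ofReal_natCast]
          refine ENNReal.ofReal_le_ofReal ?_
          rw [Nat.add_sub_cancel_left]
          refine le_trans ?_ h3
          rcases Nat.eq_zero_or_pos t with rfl | ht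
          · simp
          · have : (1 : ℝ) ≤ t := by exact_mod_cast ht
            nlinarith
  by_contra hc0
  obtain ⟨t, ht⟩ := ENNReal.exists_nat_mul_gt hc0 hKtop
  exact absurd (hbound t) (not_le.2 ht)

/-- A bounded function of the first coordinate which is strictly superharmonic off the axes. -/
noncomputable def ratioFun (z : ℕ × ℕ) : ℝ := z.1 / (z.1 + 1)

/-- The drift of `ratioFun`. -/
noncomputable def ratioDrift (z : ℕ × ℕ) : ℝ := 1 / (2 * z.1 * (z.1 + 1) * (z.1 + 2))

/-- Only horizontal moves matter, and the second difference of `x / (x + 1)` is exactly the drift.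
-/
lemma stepMean_ratioFun {z : ℕ × ℕ} (hz : z ∉ axes) :
    stepMean α (fun z => ENNReal.ofReal (ratioFun z)) z + ENNReal.ofReal (ratioDrift z) ≤
      ENNReal.ofReal (ratioFun z) := by
  obtain ⟨x, y⟩ := z
  rcases x with _ | x
  · exact absurd (by simp [axes]) hz
  rcases y with _ | y
  · exact absurd (by simp [axes]) hz
  have hp : ∀ z, 0 ≤ ratioFun z := fun z => by unfold ratioFun; positivity
  rw [stepMean_interior hp, ← ENNReal.ofReal_add]
  · refine ENNReal.ofReal_le_ofReal (le_of_eq ?_)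
    simp only [ratioFun, ratioDrift]
    push_cast
    field_simp
    ring
  · have := hp (x + 2, y + 1); have := hp (x, y + 1); have := hp (x + 1, y + 2)
    have := hp (x + 1, y)
    positivity
  · unfold ratioDrift; positivity

/-- Either the point is far and the coordinate sum suffices, or `z.1 ≤ R` and the drift is at least
`1 / (2 * (R + 3) ^ 3)`. -/
lemma one_le_coordSum_add_ratioDrift {z : ℕ × ℕ} (hz : z ∉ axes) (R : ℕ) :
    (R + 1 : ℝ≥0∞) ≤ coordSum z +
      ENNReal.ofReal (2 * ((R : ℝ) + 3) ^ 4) * ENNReal.ofReal (ratioDrift z) := by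
  have hr : 0 ≤ ratioDrift z := by unfold ratioDrift; positivity
  rw [← ENNReal.ofReal_mul (by positivity), coordSum, ← ENNReal.ofReal_add (by positivity)
    (by positivity), show (R + 1 : ℝ≥0∞) = ENNReal.ofReal ((R + 1 : ℕ) : ℝ) by
      rw [ENNReal.ofReal_natCast]; push_cast; rfl]
  refine ENNReal.ofReal_le_ofReal ?_
  rcases le_or_gt (R + 1) (z.1 + z.2) with h | h
  · have h1 : ((R + 1 : ℕ) : ℝ) ≤ ((z.1 + z.2 : ℕ) : ℝ) := by exact_mod_cast h
    have h2 : 0 ≤ 2 * ((R : ℝ) + 3) ^ 4 * ratioDrift z := by positivity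
    linarith
  · have hx : 0 < z.1 := by
      rcases Nat.eq_zero_or_pos z.1 with h0 | h0
      · exact absurd (by simp [axes, h0]) hz
      · exact h0
    have hx' : (0 : ℝ) < z.1 := by exact_mod_cast hx
    have hxR : (z.1 : ℝ) ≤ R := by exact_mod_cast (by omega : z.1 ≤ R)
    have h3 : 2 * (z.1 : ℝ) * (z.1 + 1) * (z.1 + 2) ≤
        2 * ((R : ℝ) + 3) * (R + 3) * (R + 3) := by
      gcongr <;> linarith
    have h4 : (R : ℝ) + 3 ≤ 2 * ((R : ℝ) + 3) ^ 4 * ratioDrift z := by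
      rw [ratioDrift, mul_one_div, le_div_iff₀ (by positivity)]
      have h5 : (0 : ℝ) ≤ (R : ℝ) + 3 := by positivity
      calc ((R : ℝ) + 3) * (2 * (z.1 : ℝ) * (z.1 + 1) * (z.1 + 2))
          ≤ ((R : ℝ) + 3) * (2 * ((R : ℝ) + 3) * (R + 3) * (R + 3)) := by gcongr
        _ = _ := by ring
    have h6 : (0 : ℝ) ≤ ((z.1 + z.2 : ℕ) : ℝ) := Nat.cast_nonneg _
    push_cast at h6 ⊢
    linarith

lemma IsAxisDrivenWalk.ae_eta_succ_ne_top [IsProbabilityMeasure μ]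
    (hZ : IsAxisDrivenWalk α (1, 1) μ Z) (hα₀ : 0 < α) (hα : α < 1 / 2) (j : ℕ)
    (hρ : ∀ᵐ ω ∂μ, rho (fun n => Z n ω) j ≠ ⊤) :
    ∀ᵐ ω ∂μ, eta (fun n => Z n ω) (j + 1) ≠ ⊤ := by
  obtain ⟨A, hA, hM⟩ := hZ.exists_stoppedMean_rho_le hα₀ hα
  refine ae_nextVisit_ne_top (τ := fun s => rho s j) (B := axes) (hZ.ae_rho_notMem_axes j) hρ
    fun k c hc => ?_
  set S : Set (ℕ → ℕ × ℕ) := {s | rho s j = k} ∩ {s | s k ∈ axesᶜ} with hSdef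
  have hS : DeterminedBy k S := (causal_rho j k).inter (determinedBy_eval le_rfl _)
  set K : ℝ≥0∞ := stoppedMean μ Z (fun s => rho s j) coordSum with hK
  have hKtop : K ≠ ⊤ := ne_top_of_le_ne_top ENNReal.ofReal_ne_top (hM j)
  set e : ℕ → ℝ≥0∞ := fun t => ∫⁻ ω in {ω | (fun i => Z i ω) ∈ avoiding S axes k t},
    ENNReal.ofReal (ratioDrift (Z (k + t) ω)) ∂μ with he
  have hsum : ∑' t, e t ≠ ⊤ := by
    refine ne_top_of_le_ne_top ENNReal.one_ne_top ((hZ.tsum_avoiding_le hS (B := axes)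
      (fun s hs => hs.2) (fun z => ENNReal.ofReal (ratioFun z))
      (fun z => ENNReal.ofReal (ratioDrift z)) fun z hz => stepMean_ratioFun hz).trans ?_)
    calc ∫⁻ ω in {ω | (fun i => Z i ω) ∈ S}, ENNReal.ofReal (ratioFun (Z k ω)) ∂μ
        ≤ ∫⁻ _ in {ω | (fun i => Z i ω) ∈ S}, 1 ∂μ := by
          refine lintegral_mono fun ω => ?_
          rw [← ENNReal.ofReal_one]
          refine ENNReal.ofReal_le_ofReal ?_
          rw [ratioFun, div_le_one (by positivity)]
          linarith
      _ ≤ 1 := by simpa using prob_le_one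
  have he0 : Tendsto e atTop (𝓝 0) := ENNReal.tendsto_atTop_zero_of_tsum_ne_top hsum
  have hbound : ∀ R t : ℕ, (R + 1 : ℝ≥0∞) * c ≤ K + ENNReal.ofReal (2 * ((R : ℝ) + 3) ^ 4) * e t := by
    intro R t
    have h1 := hZ.setLIntegral_avoiding_le hS (B := axes) (fun s hs => hs.2)
      (fun _ => coordSum) (fun n _ z hz => (stepMean_coordSum_interior hz).le) t
    have h2 : ∫⁻ ω in {ω | (fun i => Z i ω) ∈ S}, coordSum (Z k ω) ∂μ ≤ K := by
      refine le_trans ?_ (setLIntegral_le_stoppedMean _ _ k)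
      exact lintegral_mono_set fun ω hω => hω.1
    have hms : Measurable fun ω => coordSum (Z (k + t) ω) :=
      (measurable_of_countable coordSum).comp (hZ.measurable _)
    have hmr : Measurable fun ω => ENNReal.ofReal (ratioDrift (Z (k + t) ω)) :=
      (measurable_of_countable fun z => ENNReal.ofReal (ratioDrift z)).comp (hZ.measurable _)
    calc (R + 1 : ℝ≥0∞) * c
        ≤ (R + 1 : ℝ≥0∞) * μ {ω | (fun n => Z n ω) ∈ avoiding S axes k t} := by
          gcongr; exact hc t
      _ = ∫⁻ _ in {ω | (fun n => Z n ω) ∈ avoiding S axes k t}, (R + 1 : ℝ≥0∞) ∂μ := by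
          rw [setLIntegral_const]
      _ ≤ ∫⁻ ω in {ω | (fun n => Z n ω) ∈ avoiding S axes k t}, (coordSum (Z (k + t) ω) +
          ENNReal.ofReal (2 * ((R : ℝ) + 3) ^ 4) *
            ENNReal.ofReal (ratioDrift (Z (k + t) ω))) ∂μ :=
          setLIntegral_mono' (hZ.measurableSet (hS.avoiding axes t)) fun ω hω =>
            one_le_coordSum_add_ratioDrift (hω.2 (k + t) (by omega) le_rfl) R
      _ = _ := by rw [lintegral_add_left hms, lintegral_const_mul _ hmr]
      _ ≤ _ := by gcongr; exact h1.trans h2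
  -- For fixed `R` the drift term vanishes as `t` grows, being the term of a convergent series; then
  -- `R` is arbitrary, which forces `c = 0`.
  have hlim : ∀ R : ℕ, (R + 1 : ℝ≥0∞) * c ≤ K := by
    intro R
    have h1 : Tendsto (fun t => K + ENNReal.ofReal (2 * ((R : ℝ) + 3) ^ 4) * e t) atTop
        (𝓝 (K + ENNReal.ofReal (2 * ((R : ℝ) + 3) ^ 4) * 0)) :=
      tendsto_const_nhds.add (ENNReal.Tendsto.const_mul he0 (Or.inr ENNReal.ofReal_ne_top))
    rw [mul_zero, add_zero] at h1
    exact ge_of_tendsto' h1 (hbound R)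
  by_contra hc0
  obtain ⟨R, hR⟩ := ENNReal.exists_nat_mul_gt hc0 hKtop
  have : (R : ℝ≥0∞) * c ≤ (R + 1 : ℝ≥0∞) * c := by gcongr; exact le_self_add
  exact absurd (this.trans (hlim R)) (not_le.2 hR)

lemma IsAxisDrivenWalk.ae_rho_ne_top [IsProbabilityMeasure μ]
    (hZ : IsAxisDrivenWalk α (1, 1) μ Z) (hα₀ : 0 < α) (hα : α < 1 / 2) (j : ℕ) :
    ∀ᵐ ω ∂μ, rho (fun n => Z n ω) j ≠ ⊤ := by
  induction j with
  | zero => exact Eventually.of_forall fun ω => ENat.zero_ne_top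
  | succ j ih => exact hZ.ae_rho_succ_ne_top hα₀ hα j (hZ.ae_eta_succ_ne_top hα₀ hα j ih)

/-! ### Second moment of one increment. -/

lemma dom_step_le {z w : ℕ × ℕ} (h : transition α z w ≠ 0) :
    dom w ≤ dom z + 1 ∧ dom z ≤ dom w + 1 := by
  obtain ⟨x, y⟩ := z
  rcases x with _ | x <;> rcases y with _ | y <;> simp only [transition] at h <;>
    split_ifs at h <;> simp_all only [dom, ne_eq, not_true_eq_false] <;> first | omega | skip
  all_goals
    rename_i h'
    rcases h' with rfl | h'
    · simp <;> omega
    · first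
      | (subst h'; simp)
      | (rcases h' with rfl | rfl | rfl <;> simp <;> omega)

lemma IsAxisDrivenWalk.ae_abs_dom_sub_le [IsProbabilityMeasure μ]
    (hZ : IsAxisDrivenWalk α z₀ μ Z) :
    ∀ᵐ ω ∂μ, ∀ k t : ℕ, |(dom (Z (k + t) ω) : ℝ) - dom (Z k ω)| ≤ t := by
  filter_upwards [ae_all_iff.2 hZ.ae_transition_ne_zero] with ω hω k t
  induction t with
  | zero => simp
  | succ t ih =>
    have h := dom_step_le (hω (k + t))
    have h1 : (dom (Z (k + t + 1) ω) : ℝ) ≤ dom (Z (k + t) ω) + 1 := by exact_mod_cast h.1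
    have h2 : (dom (Z (k + t) ω) : ℝ) ≤ dom (Z (k + t + 1) ω) + 1 := by exact_mod_cast h.2
    rw [← add_assoc]
    push_cast
    rw [abs_le] at ih ⊢
    constructor <;> linarith [ih.1, ih.2]

lemma IsAxisDrivenWalk.measurable_eval (hZ : IsAxisDrivenWalk α z₀ μ Z)
    {τ : (ℕ → ℕ × ℕ) → ℕ∞} (hτ : Causal τ) :
    Measurable fun ω => Z (τ fun n => Z n ω).toNat ω := by
  have hfin : ∀ n : ℕ, MeasurableSet {ω | τ (fun i => Z i ω) = n} := fun n =>
    hZ.measurableSet (hτ n)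
  have htop : MeasurableSet {ω | τ (fun i => Z i ω) = ⊤} := by
    have : {ω | τ (fun i => Z i ω) = ⊤} = (⋃ n : ℕ, {ω | τ (fun i => Z i ω) = n})ᶜ := by
      ext ω
      simp only [Set.mem_ofPred_eq, Set.mem_compl_iff, Set.mem_iUnion, not_exists]
      constructor
      · intro h n
        rw [h]
        exact ENat.top_ne_natCast n
      · intro h
        by_contra hne
        obtain ⟨n, hn⟩ := ENat.ne_top_iff_exists.1 hne
        exact h n hn.symm
    rw [this]
    exact (MeasurableSet.iUnion hfin).compl
  refine measurable_to_countable' fun z => ?_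
  -- Since `⊤.toNat = 0`, an infinite `τ` reads the value of `Z 0`.
  have : (fun ω => Z (τ fun n => Z n ω).toNat ω) ⁻¹' {z} =
      ({ω | τ (fun i => Z i ω) = ⊤} ∩ Z 0 ⁻¹' {z}) ∪
        ⋃ n : ℕ, ({ω | τ (fun i => Z i ω) = n} ∩ Z n ⁻¹' {z}) := by
    ext ω
    simp only [Set.mem_preimage, Set.mem_singleton_iff, Set.mem_union, Set.mem_inter_iff,
      Set.mem_ofPred_eq, Set.mem_iUnion]
    rcases eq_or_ne (τ fun i => Z i ω) ⊤ with h | h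
    · simp [h]
    · obtain ⟨n, hn⟩ := ENat.ne_top_iff_exists.1 h
      simp [← hn]
  rw [this]
  exact (htop.inter (hZ.measurable 0 (measurableSet_singleton z))).union
    (MeasurableSet.iUnion fun n => (hfin n).inter (hZ.measurable n (measurableSet_singleton z)))

lemma IsAxisDrivenWalk.measurable_axisIncrement (hZ : IsAxisDrivenWalk α z₀ μ Z) (j : ℕ) :
    Measurable fun ω => axisIncrement (fun n => Z n ω) (j + 1) := by
  have hd : Measurable fun z : ℕ × ℕ => (dom z : ℝ) := measurable_of_countable _
  exact (hd.comp (hZ.measurable_eval (causal_rho (j + 1)))).sub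
    (hd.comp (hZ.measurable_eval (causal_eta j)))

end

section

variable {Ω : Type*} [MeasurableSpace Ω] {μ : Measure Ω} {α : ℝ} {z₀ : ℕ × ℕ}
  {Z : ℕ → Ω → ℕ × ℕ}

/-- Second moment of the increment along an axis. -/
lemma IsAxisDrivenWalk.exists_lintegral_sq_axisIncrement_le [IsProbabilityMeasure μ]
    (hZ : IsAxisDrivenWalk α (1, 1) μ Z) (hα₀ : 0 < α) (hα : α < 1 / 2) :
    ∃ A : ℝ, 0 ≤ A ∧ ∀ j : ℕ,
      ∫⁻ ω, ENNReal.ofReal (axisIncrement (fun n => Z n ω) (j + 1) ^ 2) ∂μ ≤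
        ENNReal.ofReal (A * ((j : ℝ) + 1) ^ (2 * α / (1 - α))) := by
  obtain ⟨C, v, w, hC, hv, hw, hv0, hw0, hv1, hw1, -, hwC⟩ := exists_axisTime_bounds hα₀ hα
  obtain ⟨A, hA, hM⟩ := hZ.exists_stoppedMean_rho_le hα₀ hα
  refine ⟨C * (2 + A), by positivity, fun j => ?_⟩
  have h1α : 0 < 1 - α := by linarith
  set p : ℝ := 1 / (1 - α) with hp
  have hp0 : 0 < p := by positivity
  set n : ℝ := (j : ℝ) + 1 with hndef
  have hn : (1 : ℝ) ≤ n := by have := Nat.cast_nonneg (α := ℝ) j; linarith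
  have hn0 : 0 < n := by linarith
  -- The scale `n ^ p` is the order of the bound on the mean position, so the linearisation loses
  -- only a constant.
  have hW := hZ.stoppedMean_le_of_rpow_le (causal_eta j) (g := w) (β := 2 * α) (b := 0)
    (by linarith) (by linarith) hC le_rfl (l := n ^ p) (by positivity) (by positivity)
    (fun i => by simpa using hwC i) ((hZ.stoppedMean_eta_le j).trans (hM j))
  have hexp : p * (2 * α) = 2 * α / (1 - α) := by rw [hp]; ring
  have hmain : C * (1 + (n ^ p) ^ (2 * α)) + (0 + C * (n ^ p) ^ (2 * α - 1)) * (A * n ^ p) ≤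
      C * (2 + A) * n ^ (2 * α / (1 - α)) := by
    have e1 : (n ^ p) ^ (2 * α) = n ^ (2 * α / (1 - α)) := by
      rw [← Real.rpow_mul hn0.le, hexp]
    have e2 : (n ^ p) ^ (2 * α - 1) * n ^ p = n ^ (2 * α / (1 - α)) := by
      rw [← Real.rpow_add_one (by positivity), sub_add_cancel, e1]
    have e3 : 1 ≤ n ^ (2 * α / (1 - α)) := Real.one_le_rpow hn (by positivity)
    calc _ = C * (1 + n ^ (2 * α / (1 - α))) + C * A * ((n ^ p) ^ (2 * α - 1) * n ^ p) := by
          rw [e1]; ring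
      _ = C * (1 + n ^ (2 * α / (1 - α))) + C * A * n ^ (2 * α / (1 - α)) := by rw [e2]
      _ ≤ C * (n ^ (2 * α / (1 - α)) + n ^ (2 * α / (1 - α))) +
          C * A * n ^ (2 * α / (1 - α)) := by gcongr
      _ = _ := by ring
  refine le_trans ?_ (hW.trans (ENNReal.ofReal_le_ofReal hmain))
  refine le_trans ?_ (hZ.tsum_sq_axisTime_le hα₀ hv hw hv0 hw0 hv1 hw1 j)
  have hρ := hZ.ae_rho_ne_top hα₀ hα (j + 1)
  have hη := hZ.ae_eta_succ_ne_top hα₀ hα j (hZ.ae_rho_ne_top hα₀ hα j)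
  -- Almost sure finiteness lets the sum over finite pairs of times capture the whole integral.
  have hcover : (Set.univ : Set Ω) ≤ᵐ[μ] ⋃ k : ℕ, ⋃ n : ℕ, {ω |
      eta (fun i => Z i ω) (j + 1) = k ∧ rho (fun i => Z i ω) (j + 1) = n} := by
    filter_upwards [hρ, hη] with ω h1 h2 _
    obtain ⟨a, ha⟩ := ENat.ne_top_iff_exists.1 h1
    obtain ⟨b, hb⟩ := ENat.ne_top_iff_exists.1 h2
    exact Set.mem_iUnion.2 ⟨b, Set.mem_iUnion.2 ⟨a, hb.symm, ha.symm⟩⟩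
  rw [← setLIntegral_univ]
  refine (lintegral_mono_set' hcover).trans ((lintegral_iUnion_le _ _).trans
    (ENNReal.tsum_le_tsum fun k => (lintegral_iUnion_le _ _).trans
      (ENNReal.tsum_le_tsum fun m => ?_)))
  refine setLIntegral_mono_ae' ?_ ?_
  · refine MeasurableSet.inter (hZ.measurableSet (causal_eta j k))
      (hZ.measurableSet (causal_rho (j + 1) m))
  · filter_upwards [hZ.ae_abs_dom_sub_le] with ω hω ⟨hk, hm⟩
    have hlt : k < m := by
      have h := (nextVisit_eq_coe_iff _ _ _ _).1 ((rho_succ _ _).symm.trans hm)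
      have h' := h.1
      rw [hk] at h'
      exact_mod_cast h'
    refine ENNReal.ofReal_le_ofReal ?_
    rw [axisIncrement, hk, hm, ENat.toNat_natCast, ENat.toNat_natCast]
    have h := hω k (m - k)
    rw [show k + (m - k) = m by omega] at h
    rw [← sq_abs]
    gcongr

/-! ### Variance of the sum and conclusion. -/

lemma sum_range_rpow_le {q : ℝ} (hq : 0 ≤ q) (i : ℕ) :
    ∑ j ∈ Finset.range i, ((j : ℝ) + 1) ^ q ≤ (i : ℝ) * (i : ℝ) ^ q := by
  have h : ∀ j ∈ Finset.range i, ((j : ℝ) + 1) ^ q ≤ (i : ℝ) ^ q := by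
    intro j hj
    have : j + 1 ≤ i := Finset.mem_range.1 hj
    exact Real.rpow_le_rpow (by positivity) (by exact_mod_cast this) hq
  simpa using Finset.sum_le_sum h

/-- Centring only lowers the second moment, and Cauchy–Schwarz costs a factor `s.card`; dependence
between the `X j` plays no role. -/
lemma integral_sq_sum_sub_integral_le [IsProbabilityMeasure μ] {X : ℕ → Ω → ℝ}
    {s : Finset ℕ} (hX : ∀ j ∈ s, MemLp (X j) 2 μ) :
    ∫ ω, (∑ j ∈ s, (X j ω - ∫ ω', X j ω' ∂μ)) ^ 2 ∂μ ≤
      s.card * ∑ j ∈ s, ∫ ω, X j ω ^ 2 ∂μ := by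
  have hint : ∀ j ∈ s, Integrable (X j) μ := fun j hj => (hX j hj).integrable (by norm_num)
  have hsq : ∀ j ∈ s, Integrable (fun ω => X j ω ^ 2) μ := fun j hj => (hX j hj).integrable_sq
  have hmem : MemLp (fun ω => ∑ j ∈ s, X j ω) 2 μ := memLp_finsetSum s hX
  have h1 : ∫ ω, (∑ j ∈ s, (X j ω - ∫ ω', X j ω' ∂μ)) ^ 2 ∂μ =
      ProbabilityTheory.variance (fun ω => ∑ j ∈ s, X j ω) μ := by
    rw [ProbabilityTheory.variance_eq_integral hmem.aemeasurable, integral_finsetSum s hint]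
    simp only [Finset.sum_sub_distrib]
  rw [h1]
  refine (ProbabilityTheory.variance_le_expectation_sq hmem.aestronglyMeasurable).trans ?_
  rw [← integral_finsetSum s hsq, ← integral_const_mul]
  refine integral_mono hmem.integrable_sq ((integrable_finsetSum s hsq).const_mul _) fun ω => ?_
  exact sq_sum_le_card_mul_sum_sq

end

end AxisWalk

theorem mainTheorem7 {Ω : Type*} [MeasurableSpace Ω] (μ : Measure Ω) [IsProbabilityMeasure μ]
    (α : ℝ) (hα₀ : 0 < α) (hα : α < 1 / 2) (Z : ℕ → Ω → ℕ × ℕ)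
    (hZ : AxisWalk.IsAxisDrivenWalk α (1, 1) μ Z) :
    (∀ j : ℕ, 1 ≤ j → ∀ᵐ ω ∂μ,
      AxisWalk.eta (fun n => Z n ω) j ≠ ⊤ ∧ AxisWalk.rho (fun n => Z n ω) j ≠ ⊤) ∧
    (∀ j : ℕ, 1 ≤ j → MemLp (fun ω => AxisWalk.axisIncrement (fun n => Z n ω) j) 2 μ) ∧
    Tendsto
      (fun i : ℕ => (i : ℝ) ^ (-(2 * α + 2) / (1 - α)) *
        ∫ ω, (∑ j ∈ Finset.Icc 1 i,
          (AxisWalk.axisIncrement (fun n => Z n ω) j -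
            ∫ ω', AxisWalk.axisIncrement (fun n => Z n ω') j ∂μ)) ^ 2 ∂μ)
      atTop (𝓝 0) := by
  have h1α : 0 < 1 - α := by linarith
  obtain ⟨A, hA, hbound⟩ := hZ.exists_lintegral_sq_axisIncrement_le hα₀ hα
  have hmem : ∀ j : ℕ, 1 ≤ j →
      MemLp (fun ω => AxisWalk.axisIncrement (fun n => Z n ω) j) 2 μ := by
    intro j hj
    obtain ⟨j, rfl⟩ := Nat.exists_eq_add_of_le' hj
    have hm := (hZ.measurable_axisIncrement j).aestronglyMeasurable (μ := μ)
    rw [memLp_two_iff_integrable_sq hm]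
    refine ⟨hm.pow 2, ?_⟩
    rw [hasFiniteIntegral_iff_ofReal (Eventually.of_forall fun ω => sq_nonneg _)]
    exact (hbound j).trans_lt ENNReal.ofReal_lt_top
  refine ⟨fun j hj => ?_, hmem, ?_⟩
  · obtain ⟨j, rfl⟩ := Nat.exists_eq_add_of_le' hj
    filter_upwards [hZ.ae_rho_ne_top hα₀ hα (j + 1),
      hZ.ae_eta_succ_ne_top hα₀ hα j (hZ.ae_rho_ne_top hα₀ hα j)] with ω h1 h2
    exact ⟨h2, h1⟩
  set q : ℝ := 2 * α / (1 - α) with hq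
  have hq0 : 0 < q := by positivity
  have hint : ∀ j : ℕ, ∫ ω, AxisWalk.axisIncrement (fun n => Z n ω) (j + 1) ^ 2 ∂μ ≤
      A * ((j : ℝ) + 1) ^ q := by
    intro j
    rw [integral_eq_lintegral_of_nonneg_ae (Eventually.of_forall fun ω => sq_nonneg _)
      ((hZ.measurable_axisIncrement j).pow_const 2).aestronglyMeasurable]
    exact ENNReal.toReal_le_of_le_ofReal (by positivity) (hbound j)
  have hsum : ∀ i : ℕ, ∫ ω, (∑ j ∈ Finset.Icc 1 i,
      (AxisWalk.axisIncrement (fun n => Z n ω) j -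
        ∫ ω', AxisWalk.axisIncrement (fun n => Z n ω') j ∂μ)) ^ 2 ∂μ ≤
      A * ((i : ℝ) ^ 2 * (i : ℝ) ^ q) := by
    intro i
    refine (AxisWalk.integral_sq_sum_sub_integral_le
      (X := fun j ω => AxisWalk.axisIncrement (fun n => Z n ω) j)
      fun j hj => hmem j (Finset.mem_Icc.1 hj).1).trans ?_
    have h1 : ∑ j ∈ Finset.Icc 1 i, ∫ ω, AxisWalk.axisIncrement (fun n => Z n ω) j ^ 2 ∂μ =
        ∑ j ∈ Finset.range i, ∫ ω, AxisWalk.axisIncrement (fun n => Z n ω) (j + 1) ^ 2 ∂μ := by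
      rw [Finset.range_eq_Ico, Finset.sum_Ico_add' (fun j =>
        ∫ ω, AxisWalk.axisIncrement (fun n => Z n ω) j ^ 2 ∂μ) 0 i 1]
      rfl
    rw [h1, Nat.card_Icc, Nat.add_sub_cancel]
    calc (i : ℝ) * ∑ j ∈ Finset.range i,
          ∫ ω, AxisWalk.axisIncrement (fun n => Z n ω) (j + 1) ^ 2 ∂μ
        ≤ (i : ℝ) * ∑ j ∈ Finset.range i, A * ((j : ℝ) + 1) ^ q := by
          gcongr with j _
          exact hint j
      _ ≤ (i : ℝ) * (A * ((i : ℝ) * (i : ℝ) ^ q)) := by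
          rw [← Finset.mul_sum]
          gcongr
          exact AxisWalk.sum_range_rpow_le hq0.le i
      _ = _ := by ring
  have hlim : Tendsto (fun i : ℕ => A * (i : ℝ) ^ (-q)) atTop (𝓝 0) := by
    have := (tendsto_rpow_neg_atTop hq0).comp tendsto_natCast_atTop_atTop
    simpa using this.const_mul A
  refine tendsto_of_tendsto_of_tendsto_of_le_of_le' tendsto_const_nhds hlim ?_ ?_
  · exact Eventually.of_forall fun i => mul_nonneg (by positivity)
      (integral_nonneg fun ω => sq_nonneg _)
  · filter_upwards [eventually_gt_atTop 0] with i hi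
    have hi' : (0 : ℝ) < i := by exact_mod_cast hi
    calc _ ≤ (i : ℝ) ^ (-(2 * α + 2) / (1 - α)) * (A * ((i : ℝ) ^ 2 * (i : ℝ) ^ q)) := by
          gcongr
          exact hsum i
      _ = A * ((i : ℝ) ^ (-(2 * α + 2) / (1 - α)) * ((i : ℝ) ^ (2 : ℝ) * (i : ℝ) ^ q)) := by
          rw [Real.rpow_two]; ring
      _ = A * (i : ℝ) ^ (-q) := by
          rw [← Real.rpow_add hi', ← Real.rpow_add hi']
          -- The exponents add up: `-(2 * α + 2) / (1 - α) + 2 + q = -q`.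
          congr 2
          rw [hq]
          field_simp
          ring
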